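/- Let $n\ge 0$ and let $W(A_n)$ be the Coxeter group of type $A_n$ with generators $\sigma_1,\dots,\sigma_n$. Write $[a,b]=\sigma_a\sigma_{a+1}\cdots\sigma_b$ for $1\le a\le b\le n$. Let $w\in W(A_n)$ be a fully commutative element, given in its canonical form $$w=[i_1,j_1][i_2,j_2]\cdots[i_p,j_p],\qquad 0\le p\le n,\quad n\ge i_1>\dots>i_p\ge 1,\quad n\ge j_1>\dots>j_p\ge 1,\quad j_t\ge i_t\ (1\le t\le p).$$ *Diagrams.* Let $A=\{1,\dots,n+1\}$ be a top row and $B=\{1',\dots,(n+1)'\}$ a bottom row of dots, with the total order $1<\dots<n+1<1'<\dots<(n+1)'$ on $A\cup B$. A non-crossing diagram on $n+1$ strings is a set $D$ of arrows $(x,y)$ with $x<y$ in $A\cup B$ (tail $x$, head $y$) such that each dot is an endpoint of exactly one arrow and the arrows can be drawn in the rectangle bounded by the two rows without crossings. Let $E_i=\{(i,i+1),(i',(i+1)')\}\cup\{(k,k') : 1\le k\le n+1,\ k\ne i,i+1\}$ for $1\le i\le n$. The concatenation $D_1\ast D_2$ is obtained by placing $D_2$ below $D_1$ and deleting the circles produced.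 Let $\mathcal D=\mathcal D(w)$ be the concatenation, from top to bottom, of the $E_h$ over the letters $\sigma_h$ of the canonical word of $w$ (the identity diagram $\{(x,x')\}$ if $p=0$). For a diagram $D$ let $AD$ and $BD$ be the sets of arrows of $D$ with both endpoints in $A$, respectively in $B$, let $D^+=\{(x,y')\in D : x,y\in A,\ x<y\}$, let $\mathcal T$ and $\mathcal H$ denote the sets of tails and of heads of a set of arrows, and let $\mathcal I(D)=\mathcal T(AD)\cup\mathcal T(D^+)$ and $\mathcal J(D)=\{j\in A : (j+1)'\in\mathcal H(BD)\cup\mathcal H(D^+)\}$. The support of an element of $W(A_n)$ is the set of generators appearing in a reduced expression of it. An element is saturated in a standard parabolic subgroup $\langle\sigma_h : h\in J\rangle$ if it belongs to this subgroup and its support is $\{\sigma_h : h\in J\}$. Then $\mathcal D$ is a non-crossing diagram on $n+1$ strings, and: 1. $\mathcal I(\mathcal D)=\{i_k : 1\le k\le p\}$. 2. $\mathcal J(\mathcal D)=\{j_k : 1\le k\le p\}$. 3. $\mathcal D^+$ is the set of arrows $(i_s,(j_t+1)')$ with $1\le t<s\le p$ such that - $j_t=i_s+2(s-t)-1$; -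 for all $r$ with $t<r<s$: $j_r\ne i_s+2(s-r)-1$ and $j_t\ne i_r+2(r-t)-1$; - $\prod_{k=t+1}^{s-1}[i_k,j_k]$ is saturated in $\langle\sigma_h : i_s+1\le h\le j_t-1\rangle$. 4. If $p\ge1$, let $A(1)=\{i_1+1,\dots,j_1+1\}$ and, inductively for $1<r\le p$, let $A(r)=\emptyset$ if $i_r\in\mathcal T(\mathcal D^+)$ and otherwise $$A(r)=\{i_r+1,\dots,j_1+1\}\setminus\{i_1,\dots,i_{r-1}\}\setminus\{f_k : 1\le k\le r-1,\ A(k)\ne\emptyset\},$$ where $f_k=\min A(k)$ whenever $A(k)\neq\emptyset$. Then $A\mathcal D=\{(i_r,f_r) : 1\le r\le p,\ A(r)\ne\emptyset\}$ (the empty set if $p=0$). 5. If $p\ge1$, let $B(p)=\{i_p,\dots,j_p\}$ and, inductively for $r=p-1,\dots,1$, let $B(r)=\emptyset$ if $(j_r+1)'\in\mathcal H(\mathcal D^+)$ and otherwise $$B(r)=\{i_p,\dots,j_r\}\setminus\{j_p+1,\dots,j_{r+1}+1\}\setminus\{g_k : r+1\le k\le p,\ B(k)\ne\emptyset\},$$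 where $g_k=\max B(k)$ whenever $B(k)\neq\emptyset$. Then $B\mathcal D=\{(g_r',(j_r+1)') : 1\le r\le p,\ B(r)\ne\emptyset\}$ (the empty set if $p=0$). -/

import Mathlib

namespace FCDiagram

/-! ### Dots, arrows and non-crossing diagrams -/

/-- The dots of a diagram: `top x` is the dot `x` of the top row `A`, and `bot x` is the dot `x'` of
the bottom row `B`.  On `n + 1` strings only the numbers `1 ≤ x ≤ n + 1` are used. -/
inductive Dot : Type
  | top (x : ℕ) : Dot
  | bot (x : ℕ) : Dot

/-- The number of a dot in its row. -/
def Dot.num : Dot → ℕ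
  | .top x => x
  | .bot x => x

/-- The total order `1 < 2 < ⋯ < n + 1 < 1' < 2' < ⋯ < (n + 1)'`. -/
def Dot.Lt : Dot → Dot → Prop
  | .top x, .top y => x < y
  | .top _, .bot _ => True
  | .bot _, .top _ => False
  | .bot x, .bot y => x < y

/-- The dot belongs to `A ∪ B` for diagrams on `n + 1` strings. -/
def Dot.IsOn (n : ℕ) (d : Dot) : Prop := 1 ≤ d.num ∧ d.num ≤ n + 1

/-- The position of a dot when one runs around the boundary of the rectangle in the order
`1, 2, …, n + 1, (n + 1)', …, 2', 1'`. -/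
def Dot.pos (n : ℕ) : Dot → ℤ
  | .top x => x
  | .bot x => 2 * (n : ℤ) + 3 - x

/-- An arrow `(x, y)`, with tail `x` and head `y`. -/
abbrev Arrow : Type := Dot × Dot

/-- The dots `x` and `y` are joined in `D`. -/
def Joined (D : Set Arrow) (x y : Dot) : Prop := (x, y) ∈ D ∨ (y, x) ∈ D

/-- `D` is a non-crossing diagram on `n + 1` strings: a set of arrows `(x, y)` with `x < y` such that
each dot is joined to exactly one other dot and no two joins cross inside the rectangle. -/
structure IsDiagram (n : ℕ) (D : Set Arrow) : Prop where
  isOn : ∀ x y, (x, y) ∈ D → x.IsOn n ∧ y.IsOn n ∧ x.Lt y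
  matching : ∀ x : Dot, x.IsOn n → ∃! y, Joined D x y
  nonCrossing : ∀ a b c d, Joined D a b → Joined D c d →
    ¬ (a.pos n < c.pos n ∧ c.pos n < b.pos n ∧ b.pos n < d.pos n)

/-! ### Concatenation -/

/-- The dots of two stacked diagrams: the row (`0` top, `1` middle, `2` bottom) and the number. -/
abbrev StackDot : Type := Fin 3 × ℕ

/-- The place of a dot of the upper diagram in the stack. -/
def Dot.upper : Dot → StackDot
  | .top x => (0, x)
  | .bot x => (1, x)

/-- The place of a dot of the lower diagram in the stack. -/
def Dot.lower : Dot → StackDot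
  | .top x => (1, x)
  | .bot x => (2, x)

/-- The place of a dot of the concatenated diagram in the stack. -/
def Dot.outer : Dot → StackDot
  | .top x => (0, x)
  | .bot x => (2, x)

/-- Two dots of the stack are joined by an arrow of `D₁` (placed above) or of `D₂` (placed below). -/
def StackStep (D₁ D₂ : Set Arrow) (u v : StackDot) : Prop :=
  (∃ a ∈ D₁, u = a.1.upper ∧ v = a.2.upper) ∨ (∃ a ∈ D₂, u = a.1.lower ∧ v = a.2.lower)

/-- The concatenation `D₁ ∗ D₂`: place `D₂` below `D₁`, follow the joins from outer dot to outer dot,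
and forget the circles in the middle. -/
def concat (D₁ D₂ : Set Arrow) : Set Arrow :=
  {a | a.1.Lt a.2 ∧ Relation.EqvGen (StackStep D₁ D₂) a.1.outer a.2.outer}

/-- The identity diagram on `n + 1` strings. -/
def idDiagram (n : ℕ) : Set Arrow :=
  {a | ∃ k, 1 ≤ k ∧ k ≤ n + 1 ∧ a = (.top k, .bot k)}

/-- The diagram `E_i` on `n + 1` strings. -/
def E (n i : ℕ) : Set Arrow :=
  {(.top i, .top (i + 1)), (.bot i, .bot (i + 1))} ∪
    {a | ∃ k, ((1 ≤ k ∧ k + 1 ≤ i) ∨ (i + 2 ≤ k ∧ k ≤ n + 1)) ∧ a = (.top k, .bot k)}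

/-- The concatenation `E_{a₁} ∗ E_{a₂} ∗ ⋯ ∗ E_{aₘ}`, from top to bottom, of a word `a₁ a₂ ⋯ aₘ`. -/
def wordDiagram (n : ℕ) (ω : List ℕ) : Set Arrow :=
  ω.foldl (fun D a => concat D (E n a)) (idDiagram n)

/-! ### The components of a diagram -/

/-- `A D`: the arrows in the top row. -/
def topArrows (D : Set Arrow) : Set Arrow :=
  {a | a ∈ D ∧ ∃ x y, a = (.top x, .top y)}

/-- `B D`: the arrows in the bottom row. -/
def botArrows (D : Set Arrow) : Set Arrow :=
  {a | a ∈ D ∧ ∃ x y, a = (.bot x, .bot y)}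

/-- `D⁺`: the positive arrows from the top row to the bottom row. -/
def posArrows (D : Set Arrow) : Set Arrow :=
  {a | a ∈ D ∧ ∃ x y, x < y ∧ a = (.top x, .bot y)}

/-- The set of tails of a set of arrows. -/
def tails (X : Set Arrow) : Set Dot := {x | ∃ y, (x, y) ∈ X}

/-- The set of heads of a set of arrows. -/
def heads (X : Set Arrow) : Set Dot := {y | ∃ x, (x, y) ∈ X}

/-- `𝓘(D)`, for diagrams on `n + 1` strings. -/
def setI (n : ℕ) (D : Set Arrow) : Set ℕ :=
  {i | 1 ≤ i ∧ i ≤ n + 1 ∧ .top i ∈ tails (topArrows D ∪ posArrows D)}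

/-- `𝓙(D)`, for diagrams on `n + 1` strings. -/
def setJ (n : ℕ) (D : Set Arrow) : Set ℕ :=
  {j | 1 ≤ j ∧ j ≤ n + 1 ∧ .bot (j + 1) ∈ heads (botArrows D ∪ posArrows D)}

/-! ### Canonical forms of fully commutative elements of `W(A_n)` -/

/-- `n ≥ i₁ > ⋯ > i_p ≥ 1`, `n ≥ j₁ > ⋯ > j_p ≥ 1` and `j_t ≥ i_t`.
Only the values at `1, …, p` of the two sequences matter. -/
structure IsStandardPair (n p : ℕ) (i j : ℕ → ℕ) : Prop where
  size_le : p ≤ n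
  bounds : ∀ t, 1 ≤ t → t ≤ p → 1 ≤ i t ∧ i t ≤ j t ∧ j t ≤ n
  decr_i : ∀ s t, 1 ≤ s → s < t → t ≤ p → i t < i s
  decr_j : ∀ s t, 1 ≤ s → s < t → t ≤ p → j t < j s

/-- The word of `[i_a, j_a] [i_{a+1}, j_{a+1}] ⋯ [i_{b-1}, j_{b-1}]`, where `[x, y]` stands for
`x, x + 1, …, y`. -/
def blocksWord (i j : ℕ → ℕ) (a b : ℕ) : List ℕ :=
  (List.Ico a b).flatMap fun k => List.Ico (i k) (j k + 1)

/-- The diagram `𝓓(w)` of the element `w = [i₁, j₁] ⋯ [i_p, j_p]`. -/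
def diagram (n p : ℕ) (i j : ℕ → ℕ) : Set Arrow :=
  wordDiagram n (blocksWord i j 1 (p + 1))

/-! ### Support and saturation in a Coxeter group -/

/-- The support of `w`: the generators that appear in a reduced expression of `w`. -/
def support {B W : Type*} [Group W] {M : CoxeterMatrix B} (cs : CoxeterSystem M W) (w : W) : Set B :=
  {b | ∃ ω : List B, cs.IsReduced ω ∧ cs.wordProd ω = w ∧ b ∈ ω}

/-- `w` is saturated in the parabolic subgroup generated by the simple reflections with index in
`J`: it belongs to this subgroup and its support is all of `J`. -/
def SaturatedIn {B W : Type*} [Group W] {M : CoxeterMatrix B} (cs : CoxeterSystem M W) (J : Set B)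
    (w : W) : Prop :=
  w ∈ Subgroup.closure (cs.simple '' J) ∧ support cs w = J

/-- The generator `σ_h` of `W(A_n)`, `1 ≤ h ≤ n` (the value at other `h` is irrelevant). -/
def sigma {n : ℕ} {W : Type*} [Group W] (cs : CoxeterSystem (CoxeterMatrix.A n) W) (h : ℕ) : W :=
  if hh : 1 ≤ h ∧ h ≤ n then cs.simple ⟨h - 1, by omega⟩ else 1

/-- The product in `W(A_n)` of a word in the numbers `1, …, n`. -/
def wordElement {n : ℕ} {W : Type*} [Group W] (cs : CoxeterSystem (CoxeterMatrix.A n) W)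
    (ω : List ℕ) : W :=
  (ω.map (sigma cs)).prod

/-- The indices in `Fin n` of the generators `σ_h` with `a ≤ h ≤ b`. -/
def genRange (n a b : ℕ) : Set (Fin n) := {k | a ≤ (k : ℕ) + 1 ∧ (k : ℕ) + 1 ≤ b}

/-! ### The combinatorial rules -/

/-- The condition on `1 ≤ t < s ≤ p` under which `(i_s, (j_t + 1)')` is to be an arrow: the
equality, the minimality condition and the saturation condition. -/
structure PositiveRule {n : ℕ} {W : Type*} [Group W] (cs : CoxeterSystem (CoxeterMatrix.A n) W)
    (i j : ℕ → ℕ) (t s : ℕ) : Prop where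
  eq : (j t : ℤ) = i s + 2 * ((s : ℤ) - t) - 1
  minimal : ∀ r, t < r → r < s →
    (j r : ℤ) ≠ i s + 2 * ((s : ℤ) - r) - 1 ∧ (j t : ℤ) ≠ i r + 2 * ((r : ℤ) - t) - 1
  saturated : SaturatedIn cs (genRange n (i s + 1) (j t - 1)) (wordElement cs (blocksWord i j (t + 1) s))

/-- The sets `A(r)`, where `P` is the set of positive arrows; `f_k = min A(k)` is `sInf (A(k))`. -/
def setA (i j : ℕ → ℕ) (P : Set Arrow) (r : ℕ) : Set ℕ :=
  if r = 1 then Set.Icc (i 1 + 1) (j 1 + 1)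
  else {x | .top (i r) ∉ tails P ∧ x ∈ Set.Icc (i r + 1) (j 1 + 1) ∧
    (∀ k, 1 ≤ k → k < r → x ≠ i k) ∧
    (∀ k, 1 ≤ k → ∀ _h : k < r, (setA i j P k).Nonempty → x ≠ sInf (setA i j P k))}
termination_by r

/-- The sets `B(r)`, `r ≤ p`, where `P` is the set of positive arrows; `g_k = max B(k)` is
`sSup (B(k))`. -/
def setB (p : ℕ) (i j : ℕ → ℕ) (P : Set Arrow) (r : ℕ) : Set ℕ :=
  if r = p then Set.Icc (i p) (j p)
  else {x | .bot (j r + 1) ∉ heads P ∧ x ∈ Set.Icc (i p) (j r) ∧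
    (∀ k, r < k → k ≤ p → x ≠ j k + 1) ∧
    (∀ k, ∀ _h : r < k ∧ k ≤ p, (setB p i j P k).Nonempty → x ≠ sSup (setB p i j P k))}
termination_by p - r

end FCDiagram

/-! A non-crossing diagram is an involution of the dots, and placing `E_a` below it reconnects the
two strings through `a'` and `(a + 1)'`. Read the dots from left to right, `x'` just before `x`:
every string has a left end and a right end. Following these ends through the canonical word, the
left ends in the top row of `𝒟(w)` are the `i_k` and the right ends in the bottom row are the
`j_k + 1`.

These ends determine the diagram. Count a left end as `-1` and a right end as `1`: over any region
cut out by strings the sum is zero, so that the two ends of a string from the top row to the bottom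
row have equal heights, up to a constant the sums over the dots to their right in their rows. A
positive arrow joins `i_s` to `(j_t + 1)'` exactly when the heights agree there and at no end in
between, and the arcs inside a row are found greedily, the innermost first. The saturation condition
comes for free: if `σ_h` is missing from the support of an element, its permutation preserves
`{1, …, h}`, whereas that of a product of blocks containing `[i_r, j_r]` maps `j_r + 1` to `i_r`. -/

namespace FCDiagram

open scoped Finset

/-! ### Non-crossing diagrams as involutions of the dots -/

section Reconnect

variable {α : Type*} [DecidableEq α] {m : α → α} {a b : α}

/-- Surgery on an involution `m`: the strings `a – m a` and `b – m b` are replaced by `a – b` and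
`m a – m b`.  It is encoded as conjugation of `m` by a transposition, so that it is visibly an
involution and changes nothing when `m a = b`. -/
def reconnect (m : α → α) (a b x : α) : α :=
  Equiv.swap (m a) b (m (Equiv.swap (m a) b x))

theorem reconnect_involutive (hm : Function.Involutive m) (a b : α) :
    Function.Involutive (reconnect m a b) := fun x => by
  simp only [reconnect, Equiv.swap_apply_self, hm (Equiv.swap (m a) b x)]

theorem reconnect_eq_self_iff {x : α} :
    reconnect m a b x = x ↔ m (Equiv.swap (m a) b x) = Equiv.swap (m a) b x := by
  rw [reconnect, Equiv.swap_apply_eq_iff]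

theorem reconnect_left (hab : a ≠ b) (ha : m a ≠ a) : reconnect m a b a = b := by
  rw [reconnect, Equiv.swap_apply_of_ne_of_ne ha.symm hab, Equiv.swap_apply_left]

theorem reconnect_right (hm : Function.Involutive m) (hab : a ≠ b) (ha : m a ≠ a) :
    reconnect m a b b = a := by
  rw [reconnect, Equiv.swap_apply_right, hm, Equiv.swap_apply_of_ne_of_ne ha.symm hab]

theorem reconnect_cases (hm : Function.Involutive m) (hab : a ≠ b) (ha : m a ≠ a) (hb : m b ≠ b)
    (x : α) :
    x = a ∧ reconnect m a b x = b ∨ x = b ∧ reconnect m a b x = a ∨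
    x ≠ a ∧ x ≠ b ∧ x = m a ∧ reconnect m a b x = m b ∨
    x ≠ a ∧ x ≠ b ∧ x = m b ∧ reconnect m a b x = m a ∨
    x ≠ a ∧ x ≠ b ∧ m x ≠ a ∧ m x ≠ b ∧ reconnect m a b x = m x := by
  rcases eq_or_ne x a with rfl | hxa
  · exact .inl ⟨rfl, reconnect_left hab ha⟩
  rcases eq_or_ne x b with rfl | hxb
  · exact .inr (.inl ⟨rfl, reconnect_right hm hab ha⟩)
  rcases eq_or_ne x (m a) with rfl | hxma
  · refine .inr (.inr (.inl ⟨hxa, hxb, rfl, ?_⟩))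
    rw [reconnect, Equiv.swap_apply_left,
      Equiv.swap_apply_of_ne_of_ne (hm.injective.ne hab.symm) hb]
  rcases eq_or_ne x (m b) with rfl | hxmb
  · refine .inr (.inr (.inr (.inl ⟨hxa, hxb, rfl, ?_⟩)))
    rw [reconnect, Equiv.swap_apply_of_ne_of_ne hxma hxb, hm, Equiv.swap_apply_right]
  · have hmxb : m x ≠ b := fun h => hxmb (hm.eq_iff.1 h)
    refine .inr (.inr (.inr (.inr ⟨hxa, hxb, fun h => hxma (hm.eq_iff.1 h), hmxb, ?_⟩)))
    rw [reconnect, Equiv.swap_apply_of_ne_of_ne hxma hxb,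
      Equiv.swap_apply_of_ne_of_ne (hm.injective.ne hxa) hmxb]

end Reconnect

namespace Dot

noncomputable instance : DecidableEq Dot := Classical.decEq _

/-- The order of the dots in which a vertical line sweeping from left to right meets them, where
the dot `x'` is put just before the dot `x`. -/
def sweep : Dot → ℕ
  | .top x => 2 * x + 1
  | .bot x => 2 * x

theorem sweep_injective : Function.Injective sweep := by
  rintro (x | x) (y | y) h <;> simp only [sweep] at h
  · exact congrArg _ (by omega)
  · omega
  · omega
  · exact congrArg _ (by omega)

theorem pos_injOn (n : ℕ) : Set.InjOn (pos n) {d | d.IsOn n} := by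
  rintro (x | x) hx (y | y) hy h <;> simp only [IsOn, num, pos, Set.mem_ofPred_eq] at hx hy h
  · exact congrArg _ (by omega)
  · omega
  · omega
  · exact congrArg _ (by omega)

theorem Lt.ne {x y : Dot} (h : x.Lt y) : x ≠ y := by
  rintro rfl
  rcases x with x | x <;> simp [Lt] at h

theorem lt_or_lt_of_ne {x y : Dot} (h : x ≠ y) : x.Lt y ∨ y.Lt x := by
  rcases x with x | x <;> rcases y with y | y <;> simp_all [Lt]

end Dot

/-- The involution `m` of the dots joins them by a non-crossing diagram on `n + 1` strings; the dots
outside the diagram are its fixed points. -/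
structure IsMatching (n : ℕ) (m : Dot → Dot) : Prop where
  invol : Function.Involutive m
  fixed_iff : ∀ x, m x = x ↔ ¬ x.IsOn n
  nonCrossing : ∀ c x, ¬ (c.pos n < x.pos n ∧ x.pos n < (m c).pos n ∧ (m c).pos n < (m x).pos n)

/-- The set of arrows of an involution of the dots. -/
def arrows (m : Dot → Dot) : Set Arrow := {a | a.1.Lt a.2 ∧ m a.1 = a.2}

namespace IsMatching

variable {n : ℕ} {m : Dot → Dot} (hm : IsMatching n m)
include hm

theorem isOn_of_ne {x : Dot} (h : m x ≠ x) : x.IsOn n :=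
  by_contra fun hx => h ((hm.fixed_iff x).2 hx)

theorem ne_of_isOn {x : Dot} (h : x.IsOn n) : m x ≠ x := fun hx => (hm.fixed_iff x).1 hx h

theorem isOn_apply {x : Dot} (h : x.IsOn n) : (m x).IsOn n :=
  hm.isOn_of_ne fun h' => hm.ne_of_isOn h (hm.invol.injective h')

theorem joined_iff {x y : Dot} : Joined (arrows m) x y ↔ x ≠ y ∧ m x = y := by
  constructor
  · rintro (⟨hlt, h⟩ | ⟨hlt, h⟩)
    · exact ⟨hlt.ne, h⟩
    · exact ⟨hlt.ne.symm, hm.invol.eq_iff.1 h |>.symm⟩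
  · rintro ⟨hne, rfl⟩
    rcases Dot.lt_or_lt_of_ne hne with h | h
    · exact Or.inl ⟨h, rfl⟩
    · exact Or.inr ⟨h, hm.invol x⟩

theorem isDiagram : IsDiagram n (arrows m) where
  isOn x y h := by
    obtain ⟨hlt, rfl : m x = y⟩ := h
    have hx := hm.isOn_of_ne hlt.ne.symm
    exact ⟨hx, hm.isOn_apply hx, hlt⟩
  matching x hx := ⟨m x, hm.joined_iff.2 ⟨(hm.ne_of_isOn hx).symm, rfl⟩,
    fun y hy => (hm.joined_iff.1 hy).2.symm⟩
  nonCrossing a b c d hab hcd := by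
    obtain ⟨-, rfl⟩ := hm.joined_iff.1 hab
    obtain ⟨-, rfl⟩ := hm.joined_iff.1 hcd
    exact hm.nonCrossing a c

theorem between_apply {c u : Dot} (h₁ : c.pos n < u.pos n) (h₂ : u.pos n < (m c).pos n) :
    c.pos n < (m u).pos n ∧ (m u).pos n < (m c).pos n := by
  rcases eq_or_ne (m u) u with hu | hu
  · rw [hu]; exact ⟨h₁, h₂⟩
  have hc : c.IsOn n := hm.isOn_of_ne fun h => by rw [h] at h₂; omega
  have hmu := hm.isOn_apply (hm.isOn_of_ne hu)
  have hne : (m u).pos n ≠ c.pos n := fun h => by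
    rw [← Dot.pos_injOn n hmu hc h, hm.invol] at h₂
    omega
  have hne' : (m u).pos n ≠ (m c).pos n := fun h => by
    rw [hm.invol.injective (Dot.pos_injOn n hmu (hm.isOn_apply hc) h)] at h₁
    omega
  have := hm.nonCrossing c u
  have := hm.nonCrossing (m u) c
  rw [hm.invol u] at this
  omega

/-- Adjacent dots lie on the same side of every other string, hence so do their partners. -/
theorem between_iff_of_adjacent {a b c : Dot} (ha : a.IsOn n) (hb : b.IsOn n)
    (hab : |a.pos n - b.pos n| = 1) (hca : c ≠ a) (hcb : c ≠ b) (hmca : m c ≠ a) (hmcb : m c ≠ b) :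
    (c.pos n < (m a).pos n ∧ (m a).pos n < (m c).pos n) ↔
      (c.pos n < (m b).pos n ∧ (m b).pos n < (m c).pos n) := by
  rcases eq_or_ne (m c) c with hc | hc
  · rw [hc]; omega
  have between_iff (u : Dot) : (c.pos n < (m u).pos n ∧ (m u).pos n < (m c).pos n) ↔
      (c.pos n < u.pos n ∧ u.pos n < (m c).pos n) :=
    ⟨fun h => by simpa only [hm.invol u] using hm.between_apply h.1 h.2,
      fun h => hm.between_apply h.1 h.2⟩
  have hc := hm.isOn_of_ne hc
  have pos_ne {u v : Dot} (hu : u.IsOn n) (hv : v.IsOn n) (h : u ≠ v) : u.pos n ≠ v.pos n :=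
    fun h' => h (Dot.pos_injOn n hu hv h')
  have := pos_ne hc ha hca
  have := pos_ne hc hb hcb
  have := pos_ne (hm.isOn_apply hc) ha hmca
  have := pos_ne (hm.isOn_apply hc) hb hmcb
  rw [between_iff a, between_iff b]
  rw [abs_eq (by norm_num)] at hab
  omega

theorem reconnect {a b : Dot} (ha : a.IsOn n) (hb : b.IsOn n) (hab : |a.pos n - b.pos n| = 1) :
    IsMatching n (reconnect m a b) where
  invol := reconnect_involutive hm.invol a b
  fixed_iff x := by
    rw [reconnect_eq_self_iff, hm.fixed_iff, Equiv.swap_apply_def]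
    split_ifs with h h'
    · simp only [h, hb, hm.isOn_apply ha]
    · simp only [h', hb, hm.isOn_apply ha]
    · rfl
  nonCrossing c x := by
    have hne : a ≠ b := by rintro rfl; simp at hab
    have cases := reconnect_cases hm.invol hne (hm.ne_of_isOn ha) (hm.ne_of_isOn hb)
    have side (u : Dot) := hm.between_iff_of_adjacent (c := u) ha hb hab
    rw [abs_eq (by norm_num)] at hab
    rcases cases c with ⟨rfl, hc⟩ | ⟨rfl, hc⟩ | ⟨-, -, rfl, hc⟩ | ⟨-, -, rfl, hc⟩ |
        ⟨hca, hcb, hmca, hmcb, hc⟩ <;>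
      rcases cases x with ⟨rfl, hx⟩ | ⟨rfl, hx⟩ | ⟨-, -, rfl, hx⟩ | ⟨-, -, rfl, hx⟩ |
        ⟨hxa, hxb, hmxa, hmxb, hx⟩ <;>
      simp only [hc, hx] <;>
      first
        | omega
        | (have := side c hca hcb hmca hmcb; omega)
        | (have := side x hxa hxb hmxa hmxb; omega)
        | exact hm.nonCrossing c x

end IsMatching

/-- The involution of the identity diagram. -/
def idMatching (n : ℕ) : Dot → Dot
  | .top x => if 1 ≤ x ∧ x ≤ n + 1 then .bot x else .top x
  | .bot x => if 1 ≤ x ∧ x ≤ n + 1 then .top x else .bot x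

theorem isMatching_idMatching (n : ℕ) : IsMatching n (idMatching n) where
  invol x := by rcases x with x | x <;> simp only [idMatching] <;> split_ifs <;> simp_all
  fixed_iff x := by
    rcases x with x | x <;> simp only [idMatching, Dot.IsOn, Dot.num] <;> split_ifs <;> simp_all
  nonCrossing c x := by
    rcases c with c | c <;> rcases x with x | x <;> simp only [idMatching] <;> split_ifs <;>
      simp only [Dot.pos] <;> omega

theorem arrows_idMatching (n : ℕ) : arrows (idMatching n) = idDiagram n := by
  ext ⟨x, y⟩
  constructor
  · rintro ⟨hlt, h : idMatching n x = y⟩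
    rcases x with x | x <;> simp only [idMatching] at h <;> split_ifs at h with hx <;> subst h
    · exact ⟨x, hx.1, hx.2, rfl⟩
    · exact absurd rfl hlt.ne
    · exact hlt.elim
    · exact absurd rfl hlt.ne
  · rintro ⟨k, hk, hkn, h⟩
    obtain ⟨rfl, rfl⟩ := Prod.mk.inj h
    exact ⟨trivial, if_pos ⟨hk, hkn⟩⟩

/-! ### Concatenation with `E_a` -/

/-- The involution of the diagram obtained by placing `E_a` below the diagram of `m`. -/
noncomputable def smooth (m : Dot → Dot) (a : ℕ) : Dot → Dot :=
  reconnect m (.bot a) (.bot (a + 1))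

/-- The two ends of the string of the stack of `m` and `E_a` through a dot of the stack. -/
noncomputable def stringEnds (m : Dot → Dot) (a : ℕ) : StackDot → Sym2 Dot
  | (0, x) => s(.top x, smooth m a (.top x))
  | (1, x) => if x = a ∨ x = a + 1 then s(m (.bot a), m (.bot (a + 1)))
      else s(.bot x, smooth m a (.bot x))
  | (2, x) => s(.bot x, smooth m a (.bot x))

/-- Two dots of the stack of `m` and `E_a` lie on the same string. -/
abbrev SameString (n : ℕ) (m : Dot → Dot) (a : ℕ) : StackDot → StackDot → Prop :=
  Relation.EqvGen (StackStep (arrows m) (E n a))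

theorem stringEnds_outer (m : Dot → Dot) (a : ℕ) :
    ∀ x : Dot, stringEnds m a x.outer = s(x, smooth m a x)
  | .top _ => rfl
  | .bot _ => rfl

theorem stringEnds_upper (m : Dot → Dot) (a : ℕ) (x : Dot) :
    stringEnds m a x.upper = if x = .bot a ∨ x = .bot (a + 1)
      then s(m (.bot a), m (.bot (a + 1))) else s(x, smooth m a x) := by
  rcases x with x | x <;> simp [stringEnds, Dot.upper]

theorem isOn_bot {n a : ℕ} (ha : 1 ≤ a) (han : a ≤ n) :
    (Dot.bot a).IsOn n ∧ (Dot.bot (a + 1)).IsOn n :=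
  ⟨⟨ha, Nat.le_succ_of_le han⟩, ⟨Nat.le_add_left 1 a, Nat.succ_le_succ han⟩⟩

namespace IsMatching

variable {n a : ℕ} {m : Dot → Dot} (hm : IsMatching n m) (ha : 1 ≤ a) (han : a ≤ n)
include hm ha han

theorem smooth : IsMatching n (smooth m a) :=
  hm.reconnect (isOn_bot ha han).1 (isOn_bot ha han).2 (by simp only [Dot.pos]; norm_num)

theorem smooth_cases (x : Dot) :
    x = .bot a ∧ FCDiagram.smooth m a x = .bot (a + 1) ∨
    x = .bot (a + 1) ∧ FCDiagram.smooth m a x = .bot a ∨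
    x ≠ .bot a ∧ x ≠ .bot (a + 1) ∧ x = m (.bot a) ∧
      FCDiagram.smooth m a x = m (.bot (a + 1)) ∨
    x ≠ .bot a ∧ x ≠ .bot (a + 1) ∧ x = m (.bot (a + 1)) ∧
      FCDiagram.smooth m a x = m (.bot a) ∨
    x ≠ .bot a ∧ x ≠ .bot (a + 1) ∧ m x ≠ .bot a ∧ m x ≠ .bot (a + 1) ∧
      FCDiagram.smooth m a x = m x :=
  reconnect_cases hm.invol (by simp) (hm.ne_of_isOn (isOn_bot ha han).1)
    (hm.ne_of_isOn (isOn_bot ha han).2) x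

theorem stringEnds_upper_apply (x : Dot) :
    stringEnds m a (m x).upper = stringEnds m a x.upper := by
  have inv : ∀ y, m (m y) = y := hm.invol
  rw [stringEnds_upper, stringEnds_upper]
  have := hm.smooth_cases ha han x
  have := hm.smooth_cases ha han (m x)
  have swap : ∀ x y : Dot, s(x, y) = s(y, x) := fun x y => Sym2.eq_swap
  grind

theorem stringEnds_eq_of_stackStep {u v : StackDot} (h : StackStep (arrows m) (E n a) u v) :
    stringEnds m a u = stringEnds m a v := by
  rcases h with ⟨⟨x, y⟩, ⟨-, rfl : m x = y⟩, rfl, rfl⟩ | ⟨⟨x, y⟩, h, rfl, rfl⟩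
  · exact (hm.stringEnds_upper_apply ha han x).symm
  · rcases h with (h | h) | ⟨k, hk, h⟩ <;> obtain ⟨rfl, rfl⟩ := Prod.mk.inj h
    · simp [stringEnds, Dot.lower]
    · have hleft : FCDiagram.smooth m a (.bot a) = .bot (a + 1) := by
        have := hm.smooth_cases ha han (.bot a)
        grind
      have hright : FCDiagram.smooth m a (.bot (a + 1)) = .bot a := by
        rw [← hleft, (hm.smooth ha han).invol]
      simp only [stringEnds, Dot.lower, hleft, hright, Sym2.eq_swap]
    · have : k ≠ a ∧ k ≠ a + 1 := by omega
      simp [stringEnds, Dot.lower, this]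

theorem smooth_eq_of_sameString {x y : Dot} (hxy : x ≠ y)
    (h : SameString n m a x.outer y.outer) :
    FCDiagram.smooth m a x = y := by
  have hends : stringEnds m a x.outer = stringEnds m a y.outer := by
    generalize x.outer = u at h
    generalize y.outer = v at h
    induction h with
    | rel u v h => exact hm.stringEnds_eq_of_stackStep ha han h
    | refl u => rfl
    | symm u v _ ih => exact ih.symm
    | trans u v w _ _ ih ih' => exact ih.trans ih'
  rw [stringEnds_outer, stringEnds_outer, Sym2.eq_iff] at hends
  exact hends.elim (fun h => absurd h.1 hxy) And.right

omit ha han in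
theorem sameString_upper_apply (x : Dot) :
    SameString n m a x.upper (m x).upper := by
  rcases eq_or_ne x (m x) with h | h
  · rw [← h]; exact .refl _
  rcases Dot.lt_or_lt_of_ne h with h | h
  · exact .rel _ _ (Or.inl ⟨(x, m x), ⟨h, rfl⟩, rfl, rfl⟩)
  · exact .symm _ _ (.rel _ _ (Or.inl ⟨(m x, x), ⟨h, hm.invol x⟩, rfl, rfl⟩))

end IsMatching

theorem sameString_outer_upper {n a : ℕ} (m : Dot → Dot) {x : Dot} (hx : x.IsOn n)
    (hxa : x ≠ .bot a) (hxa' : x ≠ .bot (a + 1)) :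
    SameString n m a x.outer x.upper := by
  rcases x with x | x
  · exact .refl _
  · refine .symm _ _ (.rel _ _ (Or.inr ⟨(.top x, .bot x), Or.inr ⟨x, ?_, rfl⟩, rfl, rfl⟩))
    simp only [ne_eq, Dot.bot.injEq, Dot.IsOn, Dot.num] at hx hxa hxa'
    omega

theorem IsMatching.sameString_smooth {n a : ℕ} {m : Dot → Dot} (hm : IsMatching n m) (ha : 1 ≤ a)
    (han : a ≤ n) {x : Dot} (hx : x.IsOn n) :
    SameString n m a x.outer (FCDiagram.smooth m a x).outer := by
  have cup : StackStep (arrows m) (E n a) (Dot.bot a).upper (Dot.bot (a + 1)).upper :=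
    Or.inr ⟨(.top a, .top (a + 1)), Or.inl (Or.inl rfl), rfl, rfl⟩
  have cap : StackStep (arrows m) (E n a) (Dot.bot a).outer (Dot.bot (a + 1)).outer :=
    Or.inr ⟨(.bot a, .bot (a + 1)), Or.inl (Or.inr rfl), rfl, rfl⟩
  have upper (y : Dot) := hm.sameString_upper_apply (a := a) y
  have vertical {y : Dot} (hy : y.IsOn n) (h : y ≠ .bot a) (h' : y ≠ .bot (a + 1)) :=
    sameString_outer_upper m hy h h'
  have hsx := (hm.smooth ha han).isOn_apply hx
  have through_cup (h : m (.bot a) ≠ .bot (a + 1)) :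
      SameString n m a (m (.bot a)).outer (m (.bot (a + 1))).outer :=
    calc
      SameString n m a _ (m (.bot a)).upper :=
        vertical (hm.isOn_apply (isOn_bot ha han).1) (hm.ne_of_isOn (isOn_bot ha han).1) h
      SameString n m a _ (Dot.bot a).upper := .symm _ _ (upper _)
      SameString n m a _ (Dot.bot (a + 1)).upper := .rel _ _ cup
      SameString n m a _ (m (.bot (a + 1))).upper := upper _
      SameString n m a _ _ := .symm _ _ (vertical (hm.isOn_apply (isOn_bot ha han).2)
        (fun e => h (hm.invol.eq_iff.1 e).symm) (hm.ne_of_isOn (isOn_bot ha han).2))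
  rcases hm.smooth_cases ha han x with ⟨rfl, e⟩ | ⟨rfl, e⟩ | ⟨h, h', rfl, e⟩ | ⟨h, h', rfl, e⟩ |
      ⟨h, h', hmx, hmx', e⟩ <;>
    rw [e] at hsx ⊢
  · exact .rel _ _ cap
  · exact .symm _ _ (.rel _ _ cap)
  · exact through_cup h'
  · exact .symm _ _ (through_cup fun e => h (hm.invol.eq_iff.1 e).symm)
  · exact ((vertical hx h h').trans _ _ _ (upper x)).trans _ _ _ (.symm _ _ (vertical hsx hmx hmx'))

theorem IsMatching.concat_arrows {n a : ℕ} {m : Dot → Dot} (hm : IsMatching n m) (ha : 1 ≤ a)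
    (han : a ≤ n) : concat (arrows m) (E n a) = arrows (FCDiagram.smooth m a) := by
  ext ⟨x, y⟩
  refine and_congr_right fun hxy => ⟨fun h => hm.smooth_eq_of_sameString ha han hxy.ne h, ?_⟩
  rintro (rfl : FCDiagram.smooth m a x = y)
  exact hm.sameString_smooth ha han ((hm.smooth ha han).isOn_of_ne hxy.ne.symm)

/-! ### Left and right ends -/

/-- The dot `d` is the end of its string that a vertical line sweeping from left to right meets
first. -/
def IsLeftEnd (m : Dot → Dot) (d : Dot) : Prop := d.sweep < (m d).sweep

/-- The dot `d` is the end of its string that a vertical line sweeping from left to right meets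
last. -/
def IsRightEnd (m : Dot → Dot) (d : Dot) : Prop := (m d).sweep < d.sweep

instance (m : Dot → Dot) (d : Dot) : Decidable (IsLeftEnd m d) := Nat.decLt _ _

theorem IsLeftEnd.not_isRightEnd {m : Dot → Dot} {d : Dot} (h : IsLeftEnd m d) :
    ¬ IsRightEnd m d := lt_asymm h

theorem isLeftEnd_apply_iff {m : Dot → Dot} (hm : Function.Involutive m) {d : Dot} :
    IsLeftEnd m (m d) ↔ IsRightEnd m d := by
  rw [IsLeftEnd, IsRightEnd, hm]

theorem isRightEnd_apply_iff {m : Dot → Dot} (hm : Function.Involutive m) {d : Dot} :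
    IsRightEnd m (m d) ↔ IsLeftEnd m d := by
  rw [IsLeftEnd, IsRightEnd, hm]

theorem IsMatching.isLeftEnd_or_isRightEnd {n : ℕ} {m : Dot → Dot} (hm : IsMatching n m) {d : Dot}
    (hd : d.IsOn n) : IsLeftEnd m d ∨ IsRightEnd m d :=
  lt_or_gt_of_ne fun h => hm.ne_of_isOn hd (Dot.sweep_injective h.symm)

theorem IsMatching.isOn_of_isLeftEnd {n : ℕ} {m : Dot → Dot} (hm : IsMatching n m) {d : Dot}
    (hd : IsLeftEnd m d) : d.IsOn n :=
  hm.isOn_of_ne fun h => by simp [IsLeftEnd, h] at hd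

theorem IsMatching.isOn_of_isRightEnd {n : ℕ} {m : Dot → Dot} (hm : IsMatching n m) {d : Dot}
    (hd : IsRightEnd m d) : d.IsOn n :=
  hm.isOn_of_ne fun h => by simp [IsRightEnd, h] at hd

theorem isLeftEnd_top_iff {m : Dot → Dot} {x : ℕ} : IsLeftEnd m (.top x) ↔
    (∃ v, x < v ∧ m (.top x) = .top v) ∨ ∃ y, x < y ∧ m (.top x) = .bot y := by
  rw [IsLeftEnd]
  rcases m (.top x) with v | y <;> simp [Dot.sweep]
  omega

theorem isRightEnd_bot_iff {m : Dot → Dot} (hm : Function.Involutive m) {y : ℕ} :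
    IsRightEnd m (.bot y) ↔
      (∃ u, u < y ∧ m (.bot u) = .bot y) ∨ ∃ x, x < y ∧ m (.top x) = .bot y := by
  simp only [IsRightEnd, hm.eq_iff (y := .bot y)]
  rcases m (.bot y) with x | u <;> simp [Dot.sweep]
  omega

section Reconnect

variable {m : Dot → Dot} {a b : Dot} (hm : Function.Involutive m) (ha : m a ≠ a)
  (hab : a.sweep < b.sweep) (hmab : (m a).sweep < b.sweep) (hb : IsLeftEnd m b)
include hm ha hab hmab hb

theorem isLeftEnd_reconnect (d : Dot) :
    IsLeftEnd (reconnect m a b) d ↔ d = a ∨ d = m a ∨ d ≠ b ∧ IsLeftEnd m d := by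
  have hne : a ≠ b := fun h => hab.ne (congrArg _ h)
  have hmane : m a ≠ b := fun h => hmab.ne (congrArg _ h)
  have hmb : m b ≠ b := fun h => hb.ne (congrArg _ h.symm)
  have inv : ∀ x, m (m x) = x := hm
  simp only [IsLeftEnd] at hb ⊢
  rcases reconnect_cases hm hne ha hmb d with ⟨rfl, e⟩ | ⟨rfl, e⟩ | ⟨h, h', rfl, e⟩ |
      ⟨h, h', rfl, e⟩ | ⟨h, h', hma', _, e⟩ <;>
    rw [e]
  all_goals grind

theorem isRightEnd_reconnect (d : Dot) :
    IsRightEnd (reconnect m a b) d ↔ d = b ∨ d ≠ a ∧ d ≠ m a ∧ IsRightEnd m d := by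
  have hne : a ≠ b := fun h => hab.ne (congrArg _ h)
  have hmb : m b ≠ b := fun h => hb.ne (congrArg _ h.symm)
  have inv : ∀ x, m (m x) = x := hm
  simp only [IsRightEnd, IsLeftEnd] at hb ⊢
  rcases reconnect_cases hm hne ha hmb d with ⟨rfl, e⟩ | ⟨rfl, e⟩ | ⟨h, h', rfl, e⟩ |
      ⟨h, h', rfl, e⟩ | ⟨h, h', hma', _, e⟩ <;>
    rw [e]
  all_goals grind

end Reconnect

/-- The involution `m` describes a non-crossing diagram on `n + 1` strings in which `L` is the set
of left ends in the top row and `R` the set of right ends in the bottom row. -/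
structure HasEnds (n : ℕ) (m : Dot → Dot) (L R : Finset ℕ) : Prop extends IsMatching n m where
  top_iff : ∀ x, IsLeftEnd m (.top x) ↔ x ∈ L
  bot_iff : ∀ x, IsRightEnd m (.bot x) ↔ x ∈ R

theorem hasEnds_idMatching (n : ℕ) : HasEnds n (idMatching n) ∅ ∅ where
  toIsMatching := isMatching_idMatching n
  top_iff x := by simp only [IsLeftEnd, idMatching]; split_ifs <;> simp [Dot.sweep]
  bot_iff x := by simp only [IsRightEnd, idMatching]; split_ifs <;> simp [Dot.sweep]

namespace HasEnds

variable {n a : ℕ} {m : Dot → Dot} {L R : Finset ℕ} (hm : HasEnds n m L R)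
include hm

theorem apply_top_of_lt {x : ℕ} (hx : 1 ≤ x) (hxn : x ≤ n + 1) (hL : ∀ z ∈ L, x < z) :
    m (.top x) = .bot x := by
  induction x using Nat.strong_induction_on with | _ x ih =>
  have vertical (y : ℕ) (hy : 1 ≤ y) (hyx : y < x) : m (.top y) = .bot y :=
    ih y hyx hy (by omega) fun z hz => hyx.trans (hL z hz)
  have hon : (Dot.top x).IsOn n := ⟨hx, hxn⟩
  have hright : IsRightEnd m (.top x) := (hm.isLeftEnd_or_isRightEnd hon).resolve_left fun h =>
    (hL x ((hm.top_iff x).1 h)).false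
  have hy := (hm.isOn_apply hon).1
  rw [IsRightEnd] at hright
  rcases hmx : m (.top x) with y | y <;> rw [hmx] at hright hy <;>
    simp only [Dot.sweep, Dot.num] at hright hy
  · have := vertical y hy (by omega)
    rw [← hmx, hm.invol] at this
    cases this
  · rcases (show y ≤ x by omega).eq_or_lt with rfl | hyx
    · rfl
    · have := hm.invol.injective (hmx.trans (vertical y hy hyx).symm)
      rw [Dot.top.inj this]

theorem isLeftEnd_bot (ha : 1 ≤ a) (han : a ≤ n + 1) (haR : a ∉ R) : IsLeftEnd m (.bot a) :=
  have hon : (Dot.bot a).IsOn n := ⟨ha, han⟩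
  (hm.isLeftEnd_or_isRightEnd hon).resolve_right fun h => haR ((hm.bot_iff a).1 h)

/-- A string with the right end `a'` is extended to `(a + 1)'`. -/
theorem smooth_of_mem (ha : 1 ≤ a) (han : a ≤ n) (haR : a ∈ R) (haR' : a + 1 ∉ R) :
    HasEnds n (smooth m a) L (insert (a + 1) (R.erase a)) := by
  have hright := (hm.bot_iff a).2 haR
  have hleft := hm.isLeftEnd_bot (Nat.le_add_left 1 a) (Nat.succ_le_succ han) haR'
  have hlt : (Dot.bot a).sweep < (Dot.bot (a + 1)).sweep := by simp [Dot.sweep]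
  have hma := hm.ne_of_isOn (isOn_bot ha han).1
  refine ⟨hm.smooth ha han, fun x => ?_, fun x => ?_⟩
  · rw [smooth, isLeftEnd_reconnect hm.invol hma hlt (hright.trans hlt) hleft, ← hm.top_iff]
    have : .top x = m (.bot a) → IsLeftEnd m (.top x) := by
      rintro h
      rwa [h, isLeftEnd_apply_iff hm.invol]
    simpa using this
  · rw [smooth, isRightEnd_reconnect hm.invol hma hlt (hright.trans hlt) hleft, hm.bot_iff]
    have : x ∈ R → .bot x ≠ m (.bot a) := by
      rintro hx h
      have hx := (hm.bot_iff x).2 hx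
      rw [h, isRightEnd_apply_iff hm.invol] at hx
      exact hx.not_isRightEnd hright
    simp only [Dot.bot.injEq, ne_eq, Finset.mem_insert, Finset.mem_erase]
    tauto

/-- To the left of all the ends so far, a new string from `a` to `(a + 1)'` is started. -/
theorem smooth_of_lt (ha : 1 ≤ a) (han : a ≤ n) (haL : ∀ x ∈ L, a < x) (haR : ∀ y ∈ R, a + 1 < y) :
    HasEnds n (smooth m a) (insert a L) (insert (a + 1) R) := by
  have hma : m (.bot a) = .top a :=
    (hm.invol.eq_iff.1 (hm.apply_top_of_lt ha (Nat.le_succ_of_le han) haL)).symm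
  have hleft := hm.isLeftEnd_bot (Nat.le_add_left 1 a) (Nat.succ_le_succ han)
    fun h => (haR _ h).false
  have hlt : (Dot.bot a).sweep < (Dot.bot (a + 1)).sweep := by simp [Dot.sweep]
  have hlt' : (m (.bot a)).sweep < (Dot.bot (a + 1)).sweep := by simp [hma, Dot.sweep]; omega
  have hne := hm.ne_of_isOn (isOn_bot ha han).1
  refine ⟨hm.smooth ha han, fun x => ?_, fun x => ?_⟩
  · rw [smooth, isLeftEnd_reconnect hm.invol hne hlt hlt' hleft, hm.top_iff, hma]
    simp
  · rw [smooth, isRightEnd_reconnect hm.invol hne hlt hlt' hleft, hm.bot_iff, hma]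
    have : x ∈ R → x ≠ a := fun hx h => by have := haR x hx; omega
    simp only [Dot.bot.injEq, ne_eq, Finset.mem_insert, reduceCtorEq, not_false_eq_true, true_and]
    tauto

end HasEnds

theorem wordDiagram_concat (n : ℕ) (ω : List ℕ) (a : ℕ) :
    wordDiagram n (ω ++ [a]) = concat (wordDiagram n ω) (E n a) :=
  List.foldl_concat ..

theorem HasEnds.exists_append_Ico {n a : ℕ} {m : Dot → Dot} {L R : Finset ℕ}
    (hm : HasEnds n m L R) {ω : List ℕ} (hω : wordDiagram n ω = arrows m) (ha : 1 ≤ a)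
    (haL : ∀ x ∈ L, a < x) {b : ℕ} (hab : a ≤ b) (hbn : b ≤ n) (hbR : ∀ y ∈ R, b + 1 < y) :
    ∃ m', HasEnds n m' (insert a L) (insert (b + 1) R) ∧
      wordDiagram n (ω ++ List.Ico a (b + 1)) = arrows m' := by
  induction b, hab using Nat.le_induction with
  | base =>
    refine ⟨_, hm.smooth_of_lt ha hbn haL hbR, ?_⟩
    rw [List.Ico.succ_singleton, wordDiagram_concat, hω, hm.concat_arrows ha hbn]
  | succ b hab ih =>
    have hbR' : ∀ y ∈ R, b + 1 < y := fun y hy => Nat.lt_of_succ_lt (hbR y hy)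
    obtain ⟨m', hm', hω'⟩ := ih (Nat.le_of_succ_le hbn) hbR'
    have hext := hm'.smooth_of_mem (Nat.le_add_left 1 b) hbn (Finset.mem_insert_self _ _) (by
      rw [Finset.mem_insert, not_or]
      exact ⟨by omega, fun h => by have := hbR _ h; omega⟩)
    rw [Finset.erase_insert fun h => (hbR' _ h).false] at hext
    refine ⟨_, hext, ?_⟩
    rw [List.Ico.succ_top (Nat.le_succ_of_le hab), ← List.append_assoc, wordDiagram_concat, hω',
      hm'.concat_arrows (Nat.le_add_left 1 b) hbn]

theorem IsStandardPair.pred {n p : ℕ} {i j : ℕ → ℕ} (h : IsStandardPair n (p + 1) i j) :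
    IsStandardPair n p i j where
  size_le := Nat.le_of_succ_le h.size_le
  bounds t ht htp := h.bounds t ht (Nat.le_succ_of_le htp)
  decr_i s t hs hst htp := h.decr_i s t hs hst (Nat.le_succ_of_le htp)
  decr_j s t hs hst htp := h.decr_j s t hs hst (Nat.le_succ_of_le htp)

theorem blocksWord_succ (i j : ℕ → ℕ) {a b : ℕ} (h : a ≤ b) :
    blocksWord i j a (b + 1) = blocksWord i j a b ++ List.Ico (i b) (j b + 1) := by
  rw [blocksWord, List.Ico.succ_top h, List.flatMap_append, List.flatMap_singleton, blocksWord]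

/-- The left ends in the top row of the diagram of a canonical form. -/
def leftEnds (p : ℕ) (i : ℕ → ℕ) : Finset ℕ := (Finset.Icc 1 p).image i

/-- The right ends in the bottom row of the diagram of a canonical form. -/
def rightEnds (p : ℕ) (j : ℕ → ℕ) : Finset ℕ := (Finset.Icc 1 p).image (j · + 1)

theorem mem_leftEnds {p : ℕ} {i : ℕ → ℕ} {x : ℕ} :
    x ∈ leftEnds p i ↔ ∃ k, (1 ≤ k ∧ k ≤ p) ∧ i k = x := by
  simp only [leftEnds, Finset.mem_image, Finset.mem_Icc]

theorem mem_rightEnds {p : ℕ} {j : ℕ → ℕ} {x : ℕ} :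
    x ∈ rightEnds p j ↔ ∃ k, (1 ≤ k ∧ k ≤ p) ∧ j k + 1 = x := by
  simp only [rightEnds, Finset.mem_image, Finset.mem_Icc]

theorem apply_mem_leftEnds {p k : ℕ} (i : ℕ → ℕ) (hk : k ∈ Set.Icc 1 p) : i k ∈ leftEnds p i :=
  mem_leftEnds.2 ⟨k, hk, rfl⟩

theorem apply_mem_rightEnds {p k : ℕ} (j : ℕ → ℕ) (hk : k ∈ Set.Icc 1 p) :
    j k + 1 ∈ rightEnds p j :=
  mem_rightEnds.2 ⟨k, hk, rfl⟩

theorem leftEnds_succ (p : ℕ) (i : ℕ → ℕ) :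
    leftEnds (p + 1) i = insert (i (p + 1)) (leftEnds p i) := by
  rw [leftEnds, ← Finset.insert_Icc_right_eq_Icc_add_one (by omega), Finset.image_insert, leftEnds]

theorem rightEnds_succ (p : ℕ) (j : ℕ → ℕ) :
    rightEnds (p + 1) j = insert (j (p + 1) + 1) (rightEnds p j) :=
  leftEnds_succ p _

theorem IsStandardPair.exists_hasEnds {n p : ℕ} {i j : ℕ → ℕ} (h : IsStandardPair n p i j) :
    ∃ m, HasEnds n m (leftEnds p i) (rightEnds p j) ∧ diagram n p i j = arrows m := by
  induction p with
  | zero => exact ⟨_, hasEnds_idMatching n, (arrows_idMatching n).symm⟩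
  | succ p ih =>
    obtain ⟨m, hm, hD⟩ := ih h.pred
    obtain ⟨hi, hij, hj⟩ := h.bounds (p + 1) (Nat.le_add_left 1 p) le_rfl
    rw [leftEnds_succ, rightEnds_succ, diagram, blocksWord_succ _ _ (Nat.le_add_left 1 p)]
    refine hm.exists_append_Ico hD hi ?_ hij hj ?_
    · rintro _ hx
      obtain ⟨k, ⟨hk, hkp⟩, rfl⟩ := mem_leftEnds.1 hx
      exact h.decr_i k (p + 1) hk (by omega) le_rfl
    · rintro _ hy
      obtain ⟨k, ⟨hk, hkp⟩, rfl⟩ := mem_rightEnds.1 hy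
      exact Nat.succ_lt_succ (h.decr_j k (p + 1) hk (by omega) le_rfl)

/-! ### Heights -/

section Height

variable (V : Finset ℕ)

/-- The column `a` raised by two for each element of `V` to its right.  Going to the right, the
height falls by one at the elements of `V` and rises by one elsewhere. -/
def height (a : ℕ) : ℤ := a + 2 * #{v ∈ V | a < v}

variable {V}

theorem height_succ_of_mem {a : ℕ} (h : a + 1 ∈ V) : height V (a + 1) = height V a - 1 := by
  have : {v ∈ V | a < v} = insert (a + 1) {v ∈ V | a + 1 < v} := by grind
  rw [height, height, this, Finset.card_insert_of_notMem (by simp)]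
  push_cast
  ring

theorem height_succ_of_notMem {a : ℕ} (h : a + 1 ∉ V) : height V (a + 1) = height V a + 1 := by
  have : {v ∈ V | a < v} = {v ∈ V | a + 1 < v} := by grind
  rw [height, height, this]
  push_cast
  ring

theorem height_pred_of_mem {a : ℕ} (ha : 1 ≤ a) (h : a ∈ V) :
    height V (a - 1) = height V a + 1 := by
  obtain ⟨a, rfl⟩ := Nat.exists_eq_add_of_le' ha
  rw [height_succ_of_mem h, Nat.add_sub_cancel, sub_add_cancel]

theorem height_pred_of_notMem {a : ℕ} (ha : 1 ≤ a) (h : a ∉ V) :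
    height V (a - 1) = height V a - 1 := by
  obtain ⟨a, rfl⟩ := Nat.exists_eq_add_of_le' ha
  rw [height_succ_of_notMem h, Nat.add_sub_cancel, add_sub_cancel_right]

theorem height_eq_self {a : ℕ} (h : ∀ v ∈ V, v ≤ a) : height V a = a := by
  rw [height, Finset.filter_false_of_mem fun v hv => (h v hv).not_gt]
  simp

theorem sum_ite_mem_Ioc {a b : ℕ} (hab : a ≤ b) :
    ∑ x ∈ Finset.Ioc a b, (if x ∈ V then -1 else 1) = height V b - height V a := by
  induction b, hab using Nat.le_induction with
  | base => simp
  | succ b hab ih =>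
    rw [← Finset.insert_Ioc_right_eq_Ioc_add_one hab, Finset.sum_insert (by simp), ih]
    split_ifs with h
    · rw [height_succ_of_mem h]; ring
    · rw [height_succ_of_notMem h]; ring

theorem exists_height_eq {a b : ℕ} (hab : a ≤ b) {h : ℤ} (hb : height V b ≤ h)
    (ha : h < height V a) : ∃ z ∈ V, a < z ∧ z ≤ b ∧ height V z = h := by
  induction b, hab using Nat.le_induction with
  | base => exact absurd hb ha.not_ge
  | succ b hab ih =>
    rcases le_or_gt (height V b) h with hbh | hbh
    · obtain ⟨z, hz, haz, hzb, e⟩ := ih hbh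
      exact ⟨z, hz, haz, Nat.le_succ_of_le hzb, e⟩
    · by_cases hmem : b + 1 ∈ V
      · refine ⟨b + 1, hmem, Nat.lt_succ_of_le hab, le_rfl, ?_⟩
        rw [height_succ_of_mem hmem] at hb ⊢
        omega
      · rw [height_succ_of_notMem hmem] at hb
        omega

end Height

/-- The left end of a string counts `-1` and the right end `1`. -/
def endSign (m : Dot → Dot) (d : Dot) : ℤ := if IsLeftEnd m d then -1 else 1

/-- The dots of the top row in `(a, b]` and those of the bottom row in `(c, d]`. -/
noncomputable def dotsIoc (a b c d : ℕ) : Finset Dot :=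
  (Finset.Ioc a b).image .top ∪ (Finset.Ioc c d).image .bot

theorem top_mem_dotsIoc {a b c d x : ℕ} : .top x ∈ dotsIoc a b c d ↔ a < x ∧ x ≤ b := by
  simp [dotsIoc]

theorem bot_mem_dotsIoc {a b c d x : ℕ} : .bot x ∈ dotsIoc a b c d ↔ c < x ∧ x ≤ d := by
  simp [dotsIoc]

theorem isOn_of_mem_dotsIoc {n a b c d : ℕ} (hb : b ≤ n + 1) (hd : d ≤ n + 1) :
    ∀ x ∈ dotsIoc a b c d, x.IsOn n := by
  rintro (x | x) hx
  · rw [top_mem_dotsIoc] at hx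
    exact ⟨by simp only [Dot.num]; omega, hx.2.trans hb⟩
  · rw [bot_mem_dotsIoc] at hx
    exact ⟨by simp only [Dot.num]; omega, hx.2.trans hd⟩

namespace IsMatching

variable {n : ℕ} {m : Dot → Dot} (hm : IsMatching n m) {S : Finset Dot} (hS : ∀ d ∈ S, d.IsOn n)
include hm hS

theorem sum_endSign_eq_zero (hmS : ∀ d ∈ S, m d ∈ S) : ∑ d ∈ S, endSign m d = 0 := by
  refine Finset.sum_involution (fun d _ => m d) (fun d hd => ?_)
    (fun d hd _ => hm.ne_of_isOn (hS d hd)) (fun d hd => hmS d hd) (fun d _ => hm.invol d)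
  have := hm.isLeftEnd_or_isRightEnd (hS d hd)
  simp only [IsLeftEnd, IsRightEnd] at this
  simp only [endSign, IsLeftEnd, hm.invol d]
  split_ifs <;> omega

theorem sum_endSign_nonneg (hmS : ∀ d ∈ S, IsLeftEnd m d → m d ∈ S) :
    0 ≤ ∑ d ∈ S, endSign m d := by
  rw [← Finset.sum_filter_add_sum_filter_not S (fun d => m d ∈ S), hm.sum_endSign_eq_zero
    (fun d hd => hS d (Finset.mem_filter.1 hd).1)
    (fun d hd => by simp only [Finset.mem_filter, hm.invol d] at hd ⊢; exact hd.symm), zero_add]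
  refine Finset.sum_nonneg fun d hd => ?_
  obtain ⟨hd, hmd⟩ := Finset.mem_filter.1 hd
  rw [endSign, if_neg fun h => hmd (hmS d hd h)]
  exact zero_le_one

end IsMatching

namespace HasEnds

variable {n : ℕ} {m : Dot → Dot} {L R : Finset ℕ} (hm : HasEnds n m L R)
include hm

theorem sum_endSign_dotsIoc {a b c d : ℕ} (hab : a ≤ b) (hcd : c ≤ d) (hd : d ≤ n + 1) :
    ∑ x ∈ dotsIoc a b c d, endSign m x =
      height L b - height L a - (height R d - height R c) := by
  have htop (x : ℕ) : endSign m (.top x) = if x ∈ L then -1 else 1 :=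
    if_congr (hm.top_iff x) rfl rfl
  have hbot (x : ℕ) (hx : x ∈ Finset.Ioc c d) :
      endSign m (.bot x) = -(if x ∈ R then -1 else 1) := by
    have hon := isOn_of_mem_dotsIoc (a := 0) (b := 0) (Nat.zero_le _) hd (.bot x)
      (bot_mem_dotsIoc.2 (Finset.mem_Ioc.1 hx))
    by_cases h : x ∈ R
    · rw [endSign, if_neg fun h' => h'.not_isRightEnd ((hm.bot_iff x).2 h), if_pos h, neg_neg]
    · rw [endSign, if_neg h, if_pos]
      exact (hm.isLeftEnd_or_isRightEnd hon).resolve_right fun h' => h ((hm.bot_iff x).1 h')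
  rw [dotsIoc, Finset.sum_union, Finset.sum_image (by simp), Finset.sum_image (by simp),
    Finset.sum_congr rfl fun x _ => htop x, Finset.sum_congr rfl hbot, Finset.sum_neg_distrib,
    sum_ite_mem_Ioc hab, sum_ite_mem_Ioc hcd]
  · ring
  · simp only [Finset.disjoint_left, Finset.mem_image]
    rintro _ ⟨_, _, rfl⟩ ⟨_, _, h⟩
    cases h

theorem isOn_top {x : ℕ} (hx : x ∈ L) : (Dot.top x).IsOn n :=
  hm.isOn_of_isLeftEnd ((hm.top_iff x).2 hx)

theorem isOn_bot {y : ℕ} (hy : y ∈ R) : (Dot.bot y).IsOn n :=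
  hm.isOn_of_isRightEnd ((hm.bot_iff y).2 hy)

theorem height_left_last : height L (n + 1) = n + 1 :=
  mod_cast height_eq_self fun _ hx => (hm.isOn_top hx).2

theorem height_right_last : height R (n + 1) = n + 1 :=
  mod_cast height_eq_self fun _ hx => (hm.isOn_bot hx).2

/-- Counting ends with signs in the region to the right of `x` in the top row and of `y'` in the
bottom row: no string may have only its left end there. -/
theorem height_le_height {x y : ℕ} (hx : x ≤ n + 1) (hy : y ≤ n + 1)
    (htop : ∀ u w, x < u → u < w → m (.top u) = .bot w → y < w)
    (hbot : ∀ u w, y < u → u ≤ w → m (.bot u) = .top w → x < w) :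
    height L x ≤ height R y := by
  have hS := isOn_of_mem_dotsIoc (a := x) (c := y) (le_refl (n + 1)) (le_refl (n + 1))
  have hsum := hm.sum_endSign_nonneg hS fun d hd hleft => by
    have hmd := (hm.isOn_apply (hS d hd)).2
    rw [IsLeftEnd] at hleft
    rcases d with u | u <;> rcases h : m _ with w | w <;> rw [h] at hleft hmd <;>
      simp only [Dot.sweep, Dot.num] at hleft hmd <;>
      simp only [top_mem_dotsIoc, bot_mem_dotsIoc] at hd ⊢ <;>
      refine ⟨?_, hmd⟩
    · omega
    · exact htop u w hd.1 (by omega) h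
    · exact hbot u w hd.1 (by omega) h
    · omega
  rw [hm.sum_endSign_dotsIoc hx hy le_rfl, hm.height_left_last, hm.height_right_last] at hsum
  omega

theorem height_pred_le_height {y : ℕ} (hy : 1 ≤ y) (hyn : y ≤ n + 1) :
    height L (y - 1) ≤ height R y :=
  hm.height_le_height (by omega) hyn (fun _ _ _ _ _ => by omega) (fun _ _ _ _ _ => by omega)

end HasEnds

namespace IsMatching

variable {n : ℕ} {m : Dot → Dot} (hm : IsMatching n m) {x y v : ℕ}
include hm

theorem isOn_of_through (h : m (.top x) = .bot y) : (Dot.top x).IsOn n ∧ (Dot.bot y).IsOn n := by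
  have hx : (Dot.top x).IsOn n := hm.isOn_of_ne (by simp [h])
  exact ⟨hx, h ▸ hm.isOn_apply hx⟩

theorem isOn_of_arc_top (h : m (.top x) = .top v) (hxv : x < v) :
    (Dot.top x).IsOn n ∧ (Dot.top v).IsOn n := by
  have hx : (Dot.top x).IsOn n := hm.isOn_of_ne (by simp [h, hxv.ne'])
  exact ⟨hx, h ▸ hm.isOn_apply hx⟩

theorem apply_mem_of_through (h : m (.top x) = .bot y) :
    ∀ d ∈ dotsIoc x (n + 1) y (n + 1), m d ∈ dotsIoc x (n + 1) y (n + 1) := by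
  intro d hd
  have hxy := hm.isOn_of_through h
  have hon := isOn_of_mem_dotsIoc le_rfl le_rfl d hd
  have hmon := hm.isOn_apply hon
  have key := hm.between_apply (c := .top x) (u := d)
  rcases d with d | d <;> rcases e : m _ with e' | e' <;> rw [e] at hmon key <;>
    simp only [top_mem_dotsIoc, bot_mem_dotsIoc, h, Dot.IsOn, Dot.num, Dot.pos] at * <;> omega

theorem lt_of_through_top (h : m (.top x) = .bot y) {u w : ℕ} (hu : m (.top u) = .bot w)
    (hxu : x < u) : y < w := by
  have := hm.apply_mem_of_through h (.top u)
    (top_mem_dotsIoc.2 ⟨hxu, (hm.isOn_of_through hu).1.2⟩)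
  rw [hu] at this
  exact (bot_mem_dotsIoc.1 this).1

theorem apply_mem_of_arc_top (h : m (.top x) = .top v) (hxv : x < v) :
    ∀ d ∈ dotsIoc x (v - 1) 0 0, m d ∈ dotsIoc x (v - 1) 0 0 := by
  intro d hd
  have hv := (hm.isOn_of_arc_top h hxv).2.2
  have hon := isOn_of_mem_dotsIoc ((Nat.sub_le _ _).trans hv) (Nat.zero_le _) d hd
  have hmon := hm.isOn_apply hon
  have key := hm.between_apply (c := .top x) (u := d)
  rcases d with d | d <;> rcases e : m _ with e' | e' <;> rw [e] at hmon key <;>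
    simp only [top_mem_dotsIoc, bot_mem_dotsIoc, h, Dot.IsOn, Dot.num, Dot.pos] at * <;> omega

end IsMatching

namespace HasEnds

variable {n : ℕ} {m : Dot → Dot} {L R : Finset ℕ} (hm : HasEnds n m L R) {x y z v : ℕ}
include hm

theorem mem_left_of_apply_eq_top (h : m (.top x) = .top v) (hxv : x < v) : x ∈ L :=
  (hm.top_iff x).1 (isLeftEnd_top_iff.2 (.inl ⟨v, hxv, h⟩))

theorem mem_left_of_apply_eq_bot (h : m (.top x) = .bot y) (hxy : x < y) : x ∈ L :=
  (hm.top_iff x).1 (isLeftEnd_top_iff.2 (.inr ⟨y, hxy, h⟩))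

theorem mem_right_of_apply_eq_bot (h : m (.top x) = .bot y) (hxy : x < y) : y ∈ R :=
  (hm.bot_iff y).1 ((isRightEnd_bot_iff hm.invol).2 (.inr ⟨x, hxy, h⟩))

theorem mem_right_of_apply_bot_eq_bot {u : ℕ} (h : m (.bot u) = .bot y) (huy : u < y) : y ∈ R :=
  (hm.bot_iff y).1 ((isRightEnd_bot_iff hm.invol).2 (.inl ⟨u, huy, h⟩))

theorem height_eq_of_through (h : m (.top x) = .bot y) : height L x = height R y := by
  obtain ⟨hx, hy⟩ := hm.isOn_of_through h
  have hsum := hm.sum_endSign_eq_zero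
    (isOn_of_mem_dotsIoc le_rfl le_rfl) (hm.apply_mem_of_through h)
  rw [hm.sum_endSign_dotsIoc (a := x) (c := y) hx.2 hy.2 le_rfl, hm.height_left_last,
    hm.height_right_last] at hsum
  omega

theorem height_left_le_of_through (h : m (.top x) = .bot y) (hxz : x ≤ z) (hzy : z < y) :
    height L z ≤ height R y := by
  have hy := (hm.isOn_of_through h).2
  exact hm.height_le_height (hzy.le.trans hy.2) hy.2
    (fun u w hzu _ hu => hm.lt_of_through_top h hu (hxz.trans_lt hzu))
    (fun u w hyu huw _ => by omega)

theorem height_right_lt_of_through (h : m (.top x) = .bot y) (hxz : x ≤ z) (hzy : z < y) :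
    height R y < height R z := by
  have hxL := hm.mem_left_of_apply_eq_bot h (hxz.trans_lt hzy)
  obtain ⟨hx, hy⟩ := hm.isOn_of_through h
  simp only [Dot.IsOn, Dot.num] at hx hy
  have hle : height L (x - 1) ≤ height R z :=
    hm.height_le_height (by omega) (by omega)
      (fun u w hxu _ hu => by
        rcases (show x ≤ u by omega).eq_or_lt with rfl | hxu
        · rw [h, Dot.bot.injEq] at hu
          rwa [← hu]
        · exact hzy.trans (hm.lt_of_through_top h hu hxu))
      (fun u w hzu huw _ => by omega)
  rw [height_pred_of_mem hx.1 hxL, hm.height_eq_of_through h] at hle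
  omega

section Arc

variable (h : m (.top x) = .top v) (hxv : x < v)
include h hxv

theorem height_lt_of_arc_top : height L x < height L v := by
  have hv := (hm.isOn_of_arc_top h hxv).2.2
  have hsum := hm.sum_endSign_eq_zero
    (isOn_of_mem_dotsIoc (b := v - 1) ((Nat.sub_le _ _).trans hv) (Nat.zero_le _))
    (hm.apply_mem_of_arc_top h hxv)
  rw [hm.sum_endSign_dotsIoc (Nat.le_sub_one_of_lt hxv) le_rfl (Nat.zero_le _)] at hsum
  have hvL : v ∉ L := fun hvL => by
    have := (hm.top_iff v).2 hvL
    rw [IsLeftEnd, ← h, hm.invol, h] at this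
    simp only [Dot.sweep] at this
    omega
  rw [height_pred_of_notMem (Nat.one_le_of_lt hxv) hvL] at hsum
  omega

theorem height_left_le_of_arc_top (hxy : x ≤ y) (hyv : y ≤ v) : height L v ≤ height R y := by
  have hv := (hm.isOn_of_arc_top h hxv).2.2
  refine hm.height_le_height hv (hyv.trans hv) (fun u w _ _ _ => by omega)
    fun u w hyu huw hu => ?_
  by_contra! hwv
  rcases hwv.eq_or_lt with rfl | hwv
  · cases hm.invol.injective (hu.trans h.symm)
  · have := hm.apply_mem_of_arc_top h hxv (.top w) (top_mem_dotsIoc.2 (by omega))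
    rw [← hu, hm.invol, bot_mem_dotsIoc] at this
    omega

theorem exists_le_right_of_arc_top : ∃ r ∈ R, v ≤ r := by
  by_contra! hR
  have hle := hm.height_left_le_of_arc_top h hxv (Nat.le_sub_one_of_lt hxv) (Nat.sub_le v 1)
  rw [height_eq_self fun r hr => Nat.le_sub_one_of_lt (hR r hr), height] at hle
  omega

end Arc

/-- An end of the same height strictly between `x` and `y` would be joined first. -/
theorem apply_top_eq_bot_iff (hx : x ∈ L) (hy : y ∈ R) (hxy : x < y) :
    m (.top x) = .bot y ↔ height L x = height R y ∧
      (∀ z ∈ R, x < z → z < y → height R z ≠ height L x) ∧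
      (∀ z ∈ L, x < z → z < y → height L z ≠ height R y) := by
  constructor
  · intro h
    have heq := hm.height_eq_of_through h
    refine ⟨heq, fun z _ hxz hzy => ?_, fun z hz hxz hzy => ?_⟩
    · exact heq ▸ (hm.height_right_lt_of_through h hxz.le hzy).ne'
    · have hle := hm.height_left_le_of_through h (Nat.le_sub_one_of_lt hxz) (by omega)
      rw [height_pred_of_mem (Nat.one_le_of_lt hxz) hz] at hle
      omega
  rintro ⟨heq, hR, hL⟩
  have hleft := (hm.top_iff x).2 hx
  rw [IsLeftEnd] at hleft
  rcases h : m (.top x) with v | w <;> rw [h] at hleft <;> simp only [Dot.sweep] at hleft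
  · have hxv : x < v := by omega
    have hlt := hm.height_lt_of_arc_top h hxv
    rcases le_or_gt y v with hyv | hvy
    · have := hm.height_left_le_of_arc_top h hxv hxy.le hyv
      omega
    · have hyon := hm.isOn_bot hy
      obtain ⟨z, hz, hvz, hzy, e⟩ := exists_height_eq (Nat.le_sub_one_of_lt hvy)
        (hm.height_pred_le_height hyon.1 hyon.2) (heq ▸ hlt)
      exact absurd e (hL z hz (hxv.trans hvz) (by omega))
  · have hxw : x < w := by omega
    have hw := hm.mem_right_of_apply_eq_bot h hxw
    rcases lt_trichotomy w y with hwy | rfl | hyw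
    · exact absurd (hm.height_eq_of_through h).symm (hR w hw hxw hwy)
    · rfl
    · have := hm.height_right_lt_of_through h hxy.le hyw
      have := hm.height_eq_of_through h
      omega

end HasEnds

/-! ### Supports in Coxeter groups -/

section Support

open CoxeterSystem

variable {B W : Type*} [Group W] {M : CoxeterMatrix B} (cs : CoxeterSystem M W)

section DecidableEq

variable [DecidableEq W]

/-- The simple reflection `s_b` acting on `W × ℤ/2` by conjugation on `W`, with a change of parity
at `s_b` itself: a word then changes the parity over `t` as often as `t` occurs among its right
inversions. -/
noncomputable def reflectionPerm (b : B) : Equiv.Perm (W × ZMod 2) :=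
  Function.Involutive.toPerm
    (fun x => (cs.simple b * x.1 * cs.simple b, x.2 + if x.1 = cs.simple b then 1 else 0))
    fun x => by
      have hconj : cs.simple b * x.1 * cs.simple b = cs.simple b ↔ x.1 = cs.simple b := by
        rw [mul_eq_right, mul_eq_one_iff_inv_eq, inv_simple, eq_comm]
      ext1
      · simp [mul_assoc]
      · simp only [hconj, add_assoc, CharTwo.add_self_eq_zero, add_zero]

theorem reflectionPerm_apply (b : B) (x : W × ZMod 2) :
    reflectionPerm cs b x =
      (cs.simple b * x.1 * cs.simple b, x.2 + if x.1 = cs.simple b then 1 else 0) := rfl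

theorem prod_map_reflectionPerm_apply (ω : List B) (x : W × ZMod 2) :
    (ω.map (reflectionPerm cs)).prod x =
      (cs.wordProd ω * x.1 * (cs.wordProd ω)⁻¹, x.2 + (cs.rightInvSeq ω).count x.1) := by
  induction ω with
  | nil => simp
  | cons b ω ih =>
    have hconj : cs.wordProd ω * x.1 * (cs.wordProd ω)⁻¹ = cs.simple b ↔
        (cs.wordProd ω)⁻¹ * cs.simple b * cs.wordProd ω = x.1 := by
      rw [mul_inv_eq_iff_eq_mul, mul_assoc, inv_mul_eq_iff_eq_mul, eq_comm]
    rw [List.map_cons, List.prod_cons, Equiv.Perm.mul_apply, ih, reflectionPerm_apply,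
      rightInvSeq, List.count_cons, wordProd_cons]
    ext1
    · simp only [mul_inv_rev, inv_simple, mul_assoc]
    · simp only [hconj, beq_iff_eq, add_assoc]
      split_ifs <;> simp

theorem prod_map_reverse_alternatingWord {G : Type*} [Monoid G] (f : B → G) (b c : B) (k : ℕ) :
    ((alternatingWord c b (2 * k)).reverse.map f).prod = (f b * f c) ^ k := by
  induction k with
  | zero => simp [alternatingWord]
  | succ k ih =>
    rw [show 2 * (k + 1) = 2 * k + 1 + 1 by ring, alternatingWord_succ, alternatingWord_succ,
      pow_succ', ← ih]
    simp [mul_assoc]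

theorem even_count_leftInvSeq_alternatingWord (b c : B) (t : W) :
    Even ((cs.leftInvSeq (alternatingWord b c (2 * M c b))).count t) := by
  set L := cs.leftInvSeq (alternatingWord b c (2 * M c b)) with hL
  have hlen : L.length = 2 * M c b := by simp [hL]
  have hperiodic : L.drop (M c b) = L.take (M c b) := by
    refine List.ext_getElem (by simp only [List.length_drop, List.length_take]; omega) ?_
    intro k hk hk'
    simp only [List.length_take, hlen] at hk'
    simp only [List.getElem_drop, List.getElem_take, hL]
    rw [getElem_leftInvSeq_alternatingWord _ _ _ _ _ (by omega),
      getElem_leftInvSeq_alternatingWord _ _ _ _ _ (by omega),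
      prod_alternatingWord_eq_mul_pow, prod_alternatingWord_eq_mul_pow]
    rw [show (2 * (M c b + k) + 1) / 2 = M c b + k by omega, pow_add]
    rw [show (2 * k + 1) / 2 = k by omega]
    simp
  rw [← List.take_append_drop (M c b) L, hperiodic, List.count_append]
  exact ⟨_, rfl⟩

theorem isLiftable_reflectionPerm : M.IsLiftable (reflectionPerm cs) := by
  intro b c
  ext1 x
  rw [← prod_map_reverse_alternatingWord, prod_map_reflectionPerm_apply, rightInvSeq_reverse,
    List.count_reverse, (even_count_leftInvSeq_alternatingWord cs c b x.1).natCast_zmod_two]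
  simp [wordProd, prod_map_reverse_alternatingWord, -List.map_reverse]

/-- The action of `W` on `W × ℤ/2` in which the simple reflections act by `reflectionPerm`. -/
noncomputable def reflectionAction : W →* Equiv.Perm (W × ZMod 2) :=
  cs.lift ⟨_, isLiftable_reflectionPerm cs⟩

theorem reflectionAction_simple (b : B) :
    reflectionAction cs (cs.simple b) = reflectionPerm cs b :=
  cs.lift_apply_simple _ b

theorem reflectionAction_wordProd (ω : List B) (x : W × ZMod 2) :
    reflectionAction cs (cs.wordProd ω) x =
      (cs.wordProd ω * x.1 * (cs.wordProd ω)⁻¹, x.2 + (cs.rightInvSeq ω).count x.1) := by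
  rw [← prod_map_reflectionPerm_apply, wordProd, map_list_prod, List.map_map]
  simp only [Function.comp_def, reflectionAction_simple]

theorem reflectionAction_apply_fst (w : W) (x : W × ZMod 2) :
    (reflectionAction cs w x).1 = w * x.1 * w⁻¹ := by
  obtain ⟨ω, rfl⟩ := cs.wordProd_surjective w
  rw [reflectionAction_wordProd]

theorem reflectionAction_apply_snd {K : Set B} {w : W}
    (hw : w ∈ Subgroup.closure (cs.simple '' K)) {x : W × ZMod 2}
    (hx : x.1 ∉ Subgroup.closure (cs.simple '' K)) :
    (reflectionAction cs w x).2 = x.2 := by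
  have conj_notMem : ∀ v ∈ Subgroup.closure (cs.simple '' K), ∀ x : W × ZMod 2,
      x.1 ∉ Subgroup.closure (cs.simple '' K) →
        (reflectionAction cs v x).1 ∉ Subgroup.closure (cs.simple '' K) := by
    intro v hv x hx
    rwa [reflectionAction_apply_fst, mul_mem_cancel_right (inv_mem hv), mul_mem_cancel_left hv]
  induction hw using Subgroup.closure_induction generalizing x with
  | mem v hv =>
    obtain ⟨b, hb, rfl⟩ := hv
    have hne : x.1 ≠ cs.simple b := fun h => hx (h ▸ Subgroup.subset_closure ⟨b, hb, rfl⟩)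
    simp [reflectionAction_simple, reflectionPerm_apply, hne]
  | one => simp
  | mul u v _ hv ihu ihv =>
    rw [map_mul, Equiv.Perm.mul_apply, ihu (conj_notMem v hv x hx), ihv hx]
  | inv v hv ih =>
    rw [← ih (conj_notMem v⁻¹ (inv_mem hv) x hx), ← Equiv.Perm.mul_apply, ← map_mul,
      mul_inv_cancel, map_one, Equiv.Perm.one_apply]

end DecidableEq

theorem mem_closure_of_mem_rightInvSeq {K : Set B} {ω : List B} (hω : cs.IsReduced ω)
    (hK : cs.wordProd ω ∈ Subgroup.closure (cs.simple '' K)) {t : W}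
    (ht : t ∈ cs.rightInvSeq ω) : t ∈ Subgroup.closure (cs.simple '' K) := by
  classical
  by_contra htK
  have h := reflectionAction_apply_snd cs hK (x := (t, 0)) htK
  simp [reflectionAction_wordProd, List.count_eq_one_of_mem hω.nodup_rightInvSeq ht] at h

theorem simple_mem_closure_of_mem {K : Set B} {ω : List B} (hω : cs.IsReduced ω)
    (hK : cs.wordProd ω ∈ Subgroup.closure (cs.simple '' K)) {b : B} (hb : b ∈ ω) :
    cs.simple b ∈ Subgroup.closure (cs.simple '' K) := by
  induction ω with
  | nil => simp at hb
  | cons c ω ih =>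
    have htail : cs.wordProd ω ∈ Subgroup.closure (cs.simple '' K) := by
      have ht := mem_closure_of_mem_rightInvSeq cs hω hK List.mem_cons_self
      rw [mul_assoc, ← wordProd_cons] at ht
      simpa using mul_mem hK (inv_mem ht)
    rcases List.mem_cons.1 hb with rfl | hb
    · simpa [wordProd_cons] using mul_mem hK (inv_mem htail)
    · exact ih (hω.drop 1) htail hb

theorem mem_closure_of_support_subset {K : Set B} {w : W} (h : support cs w ⊆ K) :
    w ∈ Subgroup.closure (cs.simple '' K) := by
  obtain ⟨ω, hω, rfl⟩ := cs.exists_isReduced w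
  refine Subgroup.list_prod_mem _ fun x hx => ?_
  obtain ⟨b, hb, rfl⟩ := List.mem_map.1 hx
  exact Subgroup.subset_closure ⟨b, h ⟨ω, hω, rfl, hb⟩, rfl⟩

end Support

/-! ### The permutation representation in type `A` -/

theorem swap_mul_swap_pow_three {α : Type*} [DecidableEq α] {x y z : α} (hxy : x ≠ y)
    (hxz : x ≠ z) (hyz : y ≠ z) : (Equiv.swap x y * Equiv.swap y z) ^ 3 = 1 := by
  have hsplit : (Equiv.swap x y * Equiv.swap y z) ^ 3 =
      Equiv.swap y x * Equiv.swap z y * Equiv.swap y x *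
        (Equiv.swap y z * Equiv.swap x y * Equiv.swap y z) := by
    simp only [Equiv.swap_comm y x, Equiv.swap_comm z y, pow_succ, pow_zero, one_mul, mul_assoc]
  rw [hsplit, Equiv.swap_mul_swap_mul_swap hyz.symm hxz.symm,
    Equiv.swap_mul_swap_mul_swap hxy hxz, Equiv.swap_comm, Equiv.swap_mul_self]

section TypeA

variable {n : ℕ}

theorem isLiftable_swap :
    (CoxeterMatrix.A n).IsLiftable fun b : Fin n => Equiv.swap ((b : ℕ) + 1) (b + 2) := by
  intro b c
  have hA : (CoxeterMatrix.A n) b c =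
    if b = c then 1 else if (c : ℕ) + 1 = b ∨ (b : ℕ) + 1 = c then 3 else 2 := rfl
  rw [hA]
  dsimp only
  split_ifs with hbc hadj
  · rw [hbc, pow_one, Equiv.swap_mul_self]
  · rcases hadj with h | h <;> rw [← h]
    · rw [Equiv.swap_comm, Equiv.swap_comm ((c : ℕ) + 1)]
      exact swap_mul_swap_pow_three (by omega) (by omega) (by omega)
    · exact swap_mul_swap_pow_three (by omega) (by omega) (by omega)
  · have hdisj : Equiv.Perm.Disjoint (Equiv.swap ((b : ℕ) + 1) (b + 2))
        (Equiv.swap ((c : ℕ) + 1) (c + 2)) := by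
      refine Equiv.Perm.disjoint_swap_swap ?_
      simp
      omega
    rw [hdisj.commute.mul_pow, pow_two, pow_two, Equiv.swap_mul_self, Equiv.swap_mul_self, one_mul]

variable {W : Type*} [Group W] (cs : CoxeterSystem (CoxeterMatrix.A n) W)

/-- The permutation representation of `W(A_n)`, in which `σ_h` exchanges `h` and `h + 1`. -/
noncomputable def permRep : W →* Equiv.Perm ℕ := cs.lift ⟨_, isLiftable_swap⟩

theorem permRep_simple (b : Fin n) :
    permRep cs (cs.simple b) = Equiv.swap ((b : ℕ) + 1) (b + 2) :=
  cs.lift_apply_simple _ b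

theorem permRep_sigma {h : ℕ} (h1 : 1 ≤ h) (hn : h ≤ n) :
    permRep cs (sigma cs h) = Equiv.swap h (h + 1) := by
  rw [sigma, dif_pos ⟨h1, hn⟩, permRep_simple]
  congr 1 <;> dsimp only <;> omega

theorem permRep_le_iff_of_mem_closure {h : Fin n} {w : W}
    (hw : w ∈ Subgroup.closure (cs.simple '' {h}ᶜ)) (x : ℕ) :
    permRep cs w x ≤ h + 1 ↔ x ≤ h + 1 := by
  induction hw using Subgroup.closure_induction generalizing x with
  | mem w hw =>
    obtain ⟨b, hb, rfl⟩ := hw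
    have hne : (h : ℕ) ≠ b := fun e => hb (Fin.ext e.symm)
    rw [permRep_simple, Equiv.swap_apply_def]
    split_ifs <;> omega
  | one => simp
  | mul u v _ _ hu hv => rw [map_mul, Equiv.Perm.mul_apply, hu, hv]
  | inv w _ ih => rw [← ih, ← Equiv.Perm.mul_apply, ← map_mul, mul_inv_cancel, map_one,
      Equiv.Perm.one_apply]

theorem simple_mem_closure_iff {K : Set (Fin n)} {b : Fin n} :
    cs.simple b ∈ Subgroup.closure (cs.simple '' K) ↔ b ∈ K := by
  refine ⟨fun h => ?_, fun h => Subgroup.subset_closure ⟨b, h, rfl⟩⟩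
  by_contra hbK
  have hle := permRep_le_iff_of_mem_closure cs (Subgroup.closure_mono
    (Set.image_mono (Set.subset_compl_singleton_iff.2 hbK)) h) ((b : ℕ) + 1)
  rw [permRep_simple, Equiv.swap_apply_left] at hle
  omega

theorem support_subset_iff {K : Set (Fin n)} {w : W} :
    support cs w ⊆ K ↔ w ∈ Subgroup.closure (cs.simple '' K) := by
  refine ⟨mem_closure_of_support_subset cs, ?_⟩
  rintro hw b ⟨ω, hω, rfl, hb⟩
  exact (simple_mem_closure_iff cs).1 (simple_mem_closure_of_mem cs hω hw hb)

theorem wordElement_append (ω ω' : List ℕ) :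
    wordElement cs (ω ++ ω') = wordElement cs ω * wordElement cs ω' := by
  simp [wordElement]

theorem wordElement_mem_closure {K : Set (Fin n)} {ω : List ℕ}
    (hω : ∀ k : Fin n, (k : ℕ) + 1 ∈ ω → k ∈ K) :
    wordElement cs ω ∈ Subgroup.closure (cs.simple '' K) := by
  refine Subgroup.list_prod_mem _ fun x hx => ?_
  obtain ⟨c, hc, rfl⟩ := List.mem_map.1 hx
  rw [sigma]
  split_ifs with hcn
  · exact Subgroup.subset_closure ⟨_, hω _ (by rwa [Nat.sub_add_cancel hcn.1]), rfl⟩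
  · exact one_mem _

theorem permRep_sigma_of_ne {c z : ℕ} (hz : z ≠ c) (hz' : z ≠ c + 1) :
    permRep cs (sigma cs c) z = z := by
  by_cases hc : 1 ≤ c ∧ c ≤ n
  · rw [permRep_sigma cs hc.1 hc.2, Equiv.swap_apply_of_ne_of_ne hz hz']
  · rw [sigma, dif_neg hc, map_one, Equiv.Perm.one_apply]

theorem permRep_wordElement_of_ne {ω : List ℕ} {z : ℕ} (hz : ∀ c ∈ ω, z ≠ c ∧ z ≠ c + 1) :
    permRep cs (wordElement cs ω) z = z := by
  induction ω with
  | nil => simp [wordElement]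
  | cons c ω ih =>
    rw [List.forall_mem_cons] at hz
    rw [wordElement, List.map_cons, List.prod_cons, map_mul, Equiv.Perm.mul_apply, ← wordElement,
      ih hz.2, permRep_sigma_of_ne cs hz.1.1 hz.1.2]

theorem permRep_wordElement_Ico {x y : ℕ} (hx : 1 ≤ x) (hxy : x ≤ y) (hy : y ≤ n + 1) :
    permRep cs (wordElement cs (List.Ico x y)) y = x := by
  induction y, hxy using Nat.le_induction with
  | base => simp [wordElement]
  | succ y hxy ih =>
    rw [List.Ico.succ_top hxy, wordElement_append, map_mul, Equiv.Perm.mul_apply]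
    have hlast : permRep cs (wordElement cs [y]) (y + 1) = y := by
      simp [wordElement, permRep_sigma cs (hx.trans hxy) (by omega : y ≤ n)]
    rw [hlast, ih (by omega)]

theorem mem_blocksWord {i j : ℕ → ℕ} {a b c : ℕ} :
    c ∈ blocksWord i j a b ↔ ∃ r, a ≤ r ∧ r < b ∧ i r ≤ c ∧ c ≤ j r := by
  simp only [blocksWord, List.mem_flatMap, List.Ico.mem, Nat.lt_succ_iff, and_assoc]

theorem blocksWord_append (i j : ℕ → ℕ) {a b c : ℕ} (hab : a ≤ b) (hbc : b ≤ c) :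
    blocksWord i j a c = blocksWord i j a b ++ blocksWord i j b c := by
  rw [blocksWord, ← List.Ico.append_consecutive hab hbc, List.flatMap_append]
  rfl

theorem IsStandardPair.permRep_wordElement_blocksWord {p : ℕ} {i j : ℕ → ℕ}
    (h : IsStandardPair n p i j) {a b r : ℕ} (ha : 1 ≤ a) (har : a ≤ r) (hrb : r < b)
    (hb : b ≤ p + 1) :
    permRep cs (wordElement cs (blocksWord i j a b)) (j r + 1) = i r := by
  have hr := h.bounds r (by omega) (by omega)
  have hlater : permRep cs (wordElement cs (blocksWord i j (r + 1) b)) (j r + 1) = j r + 1 := by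
    refine permRep_wordElement_of_ne cs fun c hc => ?_
    obtain ⟨q, hrq, hqb, -, hcj⟩ := mem_blocksWord.1 hc
    have := h.decr_j r q (by omega) (by omega) (by omega)
    omega
  have hearlier : permRep cs (wordElement cs (blocksWord i j a r)) (i r) = i r := by
    refine permRep_wordElement_of_ne cs fun c hc => ?_
    obtain ⟨q, haq, hqr, hic, -⟩ := mem_blocksWord.1 hc
    have := h.decr_i q r (by omega) (by omega) (by omega)
    omega
  have hblock : permRep cs (wordElement cs (List.Ico (i r) (j r + 1))) (j r + 1) = i r :=
    permRep_wordElement_Ico cs hr.1 (by omega) (by omega)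
  rw [blocksWord_append i j (by omega : a ≤ r + 1) (by omega : r + 1 ≤ b),
    blocksWord_succ i j har, wordElement_append, wordElement_append, map_mul, map_mul,
    Equiv.Perm.mul_apply, Equiv.Perm.mul_apply, hlater, hblock, hearlier]

theorem IsStandardPair.saturatedIn_blocksWord {p : ℕ} {i j : ℕ → ℕ} (h : IsStandardPair n p i j)
    {a b : ℕ} (ha : 1 ≤ a) (hb : b ≤ p + 1) :
    SaturatedIn cs {k | (k : ℕ) + 1 ∈ blocksWord i j a b}
      (wordElement cs (blocksWord i j a b)) := by
  have hmem := wordElement_mem_closure cs (ω := blocksWord i j a b)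
    (K := {k | (k : ℕ) + 1 ∈ blocksWord i j a b}) fun k hk => hk
  refine ⟨hmem, ((support_subset_iff cs).2 hmem).antisymm fun k hk => ?_⟩
  obtain ⟨r, har, hrb, hik, hkj⟩ := mem_blocksWord.1 hk
  -- Without the letter `k + 1`, the element would preserve `{1, …, k + 1}`.
  by_contra hsupp
  have hle := permRep_le_iff_of_mem_closure cs
    ((support_subset_iff cs).1 (Set.subset_compl_singleton_iff.2 hsupp)) (j r + 1)
  rw [h.permRep_wordElement_blocksWord cs ha har hrb hb] at hle
  omega

end TypeA

/-! ### Arrows with a given end -/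

section Arrows

variable {m : Dot → Dot} {x y : ℕ}

theorem mem_topArrows_arrows {d e : Dot} : (d, e) ∈ topArrows (arrows m) ↔
    ∃ x v, x < v ∧ m (.top x) = .top v ∧ d = .top x ∧ e = .top v := by
  constructor
  · rintro ⟨⟨hlt, hm⟩, x, v, ⟨⟩⟩
    exact ⟨x, v, hlt, hm, rfl, rfl⟩
  · rintro ⟨x, v, hlt, hm, rfl, rfl⟩
    exact ⟨⟨hlt, hm⟩, x, v, rfl⟩

theorem mem_botArrows_arrows {d e : Dot} : (d, e) ∈ botArrows (arrows m) ↔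
    ∃ u y, u < y ∧ m (.bot u) = .bot y ∧ d = .bot u ∧ e = .bot y := by
  constructor
  · rintro ⟨⟨hlt, hm⟩, u, y, ⟨⟩⟩
    exact ⟨u, y, hlt, hm, rfl, rfl⟩
  · rintro ⟨u, y, hlt, hm, rfl, rfl⟩
    exact ⟨⟨hlt, hm⟩, u, y, rfl⟩

theorem mem_posArrows_arrows {d e : Dot} : (d, e) ∈ posArrows (arrows m) ↔
    ∃ x y, x < y ∧ m (.top x) = .bot y ∧ d = .top x ∧ e = .bot y := by
  constructor
  · rintro ⟨⟨-, hm⟩, x, y, hlt, ⟨⟩⟩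
    exact ⟨x, y, hlt, hm, rfl, rfl⟩
  · rintro ⟨x, y, hlt, hm, rfl, rfl⟩
    exact ⟨⟨trivial, hm⟩, x, y, hlt, rfl⟩

theorem top_mem_tails_topArrows :
    .top x ∈ tails (topArrows (arrows m)) ↔ ∃ v, x < v ∧ m (.top x) = .top v := by
  simp [tails, mem_topArrows_arrows]

theorem bot_mem_heads_botArrows :
    .bot y ∈ heads (botArrows (arrows m)) ↔ ∃ u, u < y ∧ m (.bot u) = .bot y := by
  simp [heads, mem_botArrows_arrows]

theorem top_mem_tails_posArrows :
    .top x ∈ tails (posArrows (arrows m)) ↔ ∃ y, x < y ∧ m (.top x) = .bot y := by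
  simp [tails, mem_posArrows_arrows]

theorem bot_mem_heads_posArrows :
    .bot y ∈ heads (posArrows (arrows m)) ↔ ∃ x, x < y ∧ m (.top x) = .bot y := by
  simp [heads, mem_posArrows_arrows]

end Arrows

theorem tails_union (X Y : Set Arrow) : tails (X ∪ Y) = tails X ∪ tails Y :=
  Set.ext fun _ => exists_or

theorem heads_union (X Y : Set Arrow) : heads (X ∪ Y) = heads X ∪ heads Y :=
  Set.ext fun _ => exists_or

namespace HasEnds

variable {n : ℕ} {m : Dot → Dot} {L R : Finset ℕ} (hm : HasEnds n m L R) {x y z v u : ℕ}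
include hm

theorem setI_eq : setI n (arrows m) = L := by
  ext x
  rw [Finset.mem_coe, ← hm.top_iff, setI, tails_union, Set.mem_ofPred_eq, Set.mem_union,
    top_mem_tails_topArrows, top_mem_tails_posArrows, ← isLeftEnd_top_iff, ← and_assoc]
  exact and_iff_right_of_imp fun h => hm.isOn_of_isLeftEnd h

theorem setJ_eq : setJ n (arrows m) = {z | z + 1 ∈ R} := by
  ext z
  rw [Set.mem_ofPred_eq, ← hm.bot_iff, setJ, heads_union, Set.mem_ofPred_eq, Set.mem_union,
    bot_mem_heads_botArrows, bot_mem_heads_posArrows, ← isRightEnd_bot_iff hm.invol, ← and_assoc]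
  refine and_iff_right_of_imp fun h => ?_
  have hon := hm.isOn_of_isRightEnd h
  have hon' := (hm.isOn_apply hon).1
  rw [IsRightEnd] at h
  rcases hz : m (.bot (z + 1)) with x | u <;> rw [hz] at h hon' <;>
    simp only [Dot.sweep, Dot.IsOn, Dot.num] at h hon hon' <;> omega

theorem top_notMem_tails_posArrows (hx : x ∈ L) :
    .top x ∉ tails (posArrows (arrows m)) ↔ ∃ v, m (.top x) = .top v := by
  rw [top_mem_tails_posArrows]
  rcases isLeftEnd_top_iff.1 ((hm.top_iff x).2 hx) with ⟨v, -, h⟩ | ⟨y, hxy, h⟩ <;> simp [*]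

theorem bot_notMem_heads_posArrows (hy : y ∈ R) :
    .bot y ∉ heads (posArrows (arrows m)) ↔ ∃ u, m (.bot y) = .bot u := by
  rw [bot_mem_heads_posArrows]
  have := (isRightEnd_bot_iff hm.invol).1 ((hm.bot_iff y).2 hy)
  simp only [hm.invol.eq_iff (y := .bot y)] at this ⊢
  rcases this with ⟨u, -, h⟩ | ⟨x, hxy, h⟩
  · simp [← h]
  · simp [← h, hxy]

theorem lt_of_apply_eq_top (hx : x ∈ L) (h : m (.top x) = .top v) : x < v := by
  simpa [IsLeftEnd, h, Dot.sweep] using (hm.top_iff x).2 hx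

theorem lt_of_apply_eq_bot (hy : y ∈ R) (h : m (.bot y) = .bot u) : u < y := by
  simpa [IsRightEnd, h, Dot.sweep] using (hm.bot_iff y).2 hy

theorem exists_arc_of_nested_top (h : m (.top x) = .top v) (hxz : x < z) (hzv : z < v)
    (hz : z ∉ L) : ∃ w ∈ L, x < w ∧ m (.top w) = .top z := by
  have hx : (Dot.top x).IsOn n := hm.isOn_of_ne (by simp [h]; omega)
  have hv := hm.isOn_apply hx
  have hbetween := hm.between_apply (c := .top x) (u := .top z) (by simpa [Dot.pos])
    (by simpa [Dot.pos, h])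
  have hzon : (Dot.top z).IsOn n := by simp only [h, Dot.IsOn, Dot.num] at hx hv ⊢; omega
  have hright := (hm.isLeftEnd_or_isRightEnd hzon).resolve_left fun h => hz ((hm.top_iff z).1 h)
  rw [← isLeftEnd_apply_iff hm.invol] at hright
  have hon := hm.isOn_apply hzon
  rcases hw : m (.top z) with w | w <;> rw [hw] at hright hbetween hon <;>
    simp only [h, Dot.IsOn, Dot.num, Dot.pos] at hv hbetween hon
  · exact ⟨w, (hm.top_iff w).1 hright, by omega, by rw [← hw, hm.invol]⟩
  · omega

theorem exists_arc_of_nested_bot (h : m (.bot y) = .bot u) (huz : u < z) (hzy : z < y)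
    (hz : z ∉ R) : ∃ w ∈ R, w < y ∧ m (.bot w) = .bot z := by
  have hy : (Dot.bot y).IsOn n := hm.isOn_of_ne (by simp [h]; omega)
  have hu := hm.isOn_apply hy
  have hbetween := hm.between_apply (c := .bot y) (u := .bot z) (by simpa [Dot.pos])
    (by simpa [Dot.pos, h])
  have hzon : (Dot.bot z).IsOn n := by simp only [h, Dot.IsOn, Dot.num] at hy hu ⊢; omega
  have hleft := (hm.isLeftEnd_or_isRightEnd hzon).resolve_right fun h => hz ((hm.bot_iff z).1 h)
  rw [← isRightEnd_apply_iff hm.invol] at hleft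
  have hon := hm.isOn_apply hzon
  rcases hw : m (.bot z) with w | w <;> rw [hw] at hleft hbetween hon <;>
    simp only [Dot.IsOn, Dot.num, Dot.pos] at hy hbetween hon
  · omega
  · exact ⟨w, (hm.bot_iff w).1 hleft, by omega, by rw [← hw, hm.invol]⟩

end HasEnds

/-! ### The canonical form -/

section Enumeration

variable {p : ℕ} {u : ℕ → ℕ} (hu : StrictAntiOn u (Set.Icc 1 p)) {a k : ℕ}
include hu

theorem le_card_filter_image_iff (hk : k ∈ Set.Icc 1 p) :
    k ≤ #{v ∈ (Finset.Icc 1 p).image u | a < v} ↔ a < u k := by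
  have card_image {q : ℕ} (hq : q ≤ p) : #((Finset.Icc 1 q).image u) = q := by
    rw [Finset.card_image_of_injOn, Nat.card_Icc, Nat.add_sub_cancel]
    rw [Finset.coe_Icc]
    exact hu.injOn.mono (Set.Icc_subset_Icc_right hq)
  constructor
  · contrapose!
    intro hka
    calc #{v ∈ (Finset.Icc 1 p).image u | a < v} ≤ #((Finset.Icc 1 (k - 1)).image u) := by
          refine Finset.card_le_card fun v hv => ?_
          simp only [Finset.mem_filter, Finset.mem_image, Finset.mem_Icc] at hv ⊢
          obtain ⟨⟨l, hl, rfl⟩, hal⟩ := hv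
          have := (hu.lt_iff_gt hk hl).1 (hka.trans_lt hal)
          exact ⟨l, ⟨hl.1, Nat.le_sub_one_of_lt this⟩, rfl⟩
      _ = k - 1 := card_image ((Nat.sub_le k 1).trans hk.2)
      _ < k := Nat.sub_one_lt_of_lt hk.1
  · intro hak
    calc k = #((Finset.Icc 1 k).image u) := (card_image hk.2).symm
      _ ≤ #{v ∈ (Finset.Icc 1 p).image u | a < v} := by
          refine Finset.card_le_card fun v hv => ?_
          simp only [Finset.mem_filter, Finset.mem_image, Finset.mem_Icc] at hv ⊢
          obtain ⟨l, hl, rfl⟩ := hv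
          have hlp : l ∈ Set.Icc 1 p := ⟨hl.1, hl.2.trans hk.2⟩
          exact ⟨⟨l, hlp, rfl⟩, hak.trans_le (hu.antitoneOn hlp hk hl.2)⟩

theorem height_image_apply (hk : k ∈ Set.Icc 1 p) :
    height ((Finset.Icc 1 p).image u) (u k) = u k + 2 * ((k : ℤ) - 1) := by
  have hlt : ¬ k ≤ #{v ∈ (Finset.Icc 1 p).image u | u k < v} :=
    fun h => ((le_card_filter_image_iff hu hk).1 h).false
  have hle : k - 1 ≤ #{v ∈ (Finset.Icc 1 p).image u | u k < v} := by
    rcases hk.1.eq_or_lt with rfl | hk'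
    · exact Nat.zero_le _
    · have hk'' : k - 1 ∈ Set.Icc 1 p := ⟨by omega, by have := hk.2; omega⟩
      exact (le_card_filter_image_iff hu hk'').2 (hu hk'' hk (by omega))
  rw [height]
  omega

end Enumeration

namespace IsStandardPair

variable {n p : ℕ} {i j : ℕ → ℕ} (h : IsStandardPair n p i j) {s t c x y : ℕ}
include h

theorem strictAntiOn_i : StrictAntiOn i (Set.Icc 1 p) :=
  fun s hs t ht hst => h.decr_i s t hs.1 hst ht.2

theorem strictAntiOn_j : StrictAntiOn j (Set.Icc 1 p) :=
  fun s hs t ht hst => h.decr_j s t hs.1 hst ht.2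

theorem strictAntiOn_j_add_one : StrictAntiOn (j · + 1) (Set.Icc 1 p) :=
  fun _ hs _ ht hst => Nat.succ_lt_succ (h.strictAntiOn_j hs ht hst)

theorem height_leftEnds (hs : s ∈ Set.Icc 1 p) :
    height (leftEnds p i) (i s) = i s + 2 * ((s : ℤ) - 1) :=
  height_image_apply h.strictAntiOn_i hs

theorem height_rightEnds (ht : t ∈ Set.Icc 1 p) :
    height (rightEnds p j) (j t + 1) = j t + 1 + 2 * ((t : ℤ) - 1) :=
  height_image_apply h.strictAntiOn_j_add_one ht

variable {m : Dot → Dot} (hm : HasEnds n m (leftEnds p i) (rightEnds p j))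
include hm

theorem exists_of_apply_top_eq_bot (hxy : x < y) (e : m (.top x) = .bot y) :
    ∃ t s, 1 ≤ t ∧ t < s ∧ s ≤ p ∧ x = i s ∧ y = j t + 1 := by
  obtain ⟨s, hs, rfl⟩ := mem_leftEnds.1 (hm.mem_left_of_apply_eq_bot e hxy)
  obtain ⟨t, ht, rfl⟩ := mem_rightEnds.1 (hm.mem_right_of_apply_eq_bot e hxy)
  have := hm.height_eq_of_through e
  rw [h.height_leftEnds hs, h.height_rightEnds ht] at this
  exact ⟨t, s, ht.1, by omega, hs.2, rfl, rfl⟩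

/-- The heights count the `k` with `c < i k`, resp. `c ≤ j k`; each set is an initial segment of
`1, …, p`, and a string above column `c` makes the second exceed the first. -/
theorem mem_blocksWord_of_apply_eq (ht : 1 ≤ t) (hsp : s ≤ p) (hts : t < s)
    (e : m (.top (i s)) = .bot (j t + 1)) (hsc : i s < c) (hct : c < j t) :
    c ∈ blocksWord i j (t + 1) s := by
  have hright := hm.height_right_lt_of_through e hsc.le (by omega)
  have hleft := hm.height_left_le_of_through e hsc.le (by omega)
  have heq := hm.height_eq_of_through e
  rw [h.height_rightEnds ⟨ht, by omega⟩] at heq hleft hright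
  rw [h.height_leftEnds ⟨by omega, hsp⟩] at heq
  rw [height] at hleft hright
  set α := #{v ∈ leftEnds p i | c < v}
  set β := #{v ∈ rightEnds p j | c < v}
  have hr : max α t + 1 ∈ Set.Icc 1 p := ⟨by omega, by omega⟩
  have hi := le_card_filter_image_iff (a := c) h.strictAntiOn_i hr
  have hj := (le_card_filter_image_iff (a := c) h.strictAntiOn_j_add_one hr).1
    (show max α t + 1 ≤ β by omega)
  have hi' : ¬ c < i (max α t + 1) := fun hlt => by
    have : max α t + 1 ≤ α := hi.2 hlt
    omega
  exact mem_blocksWord.2 ⟨max α t + 1, by omega, by omega, by omega, by omega⟩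

theorem setOf_mem_blocksWord_eq_genRange (ht : 1 ≤ t) (hts : t < s) (hsp : s ≤ p)
    (e : m (.top (i s)) = .bot (j t + 1)) :
    {k : Fin n | (k : ℕ) + 1 ∈ blocksWord i j (t + 1) s} = genRange n (i s + 1) (j t - 1) := by
  ext k
  constructor
  · intro hk
    obtain ⟨r, htr, hrs, hir, hjr⟩ := mem_blocksWord.1 hk
    have := h.decr_i r s (by omega) hrs hsp
    have := h.decr_j t r ht htr (by omega)
    exact ⟨by omega, by omega⟩
  · rintro ⟨hsk, hkt⟩
    exact h.mem_blocksWord_of_apply_eq hm ht hsp hts e hsk (by omega)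

variable {W : Type*} [Group W] (cs : CoxeterSystem (CoxeterMatrix.A n) W)

theorem apply_top_eq_bot_iff_positiveRule (ht : 1 ≤ t) (hts : t < s) (hsp : s ≤ p) :
    m (.top (i s)) = .bot (j t + 1) ↔ PositiveRule cs i j t s := by
  have hs' : s ∈ Set.Icc 1 p := ⟨by omega, hsp⟩
  have ht' : t ∈ Set.Icc 1 p := ⟨ht, by omega⟩
  have hij (r : ℕ) (hr : r ∈ Set.Icc 1 p) : i r ≤ j r := (h.bounds r hr.1 hr.2).2.1
  have hst := h.strictAntiOn_i ht' hs' hts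
  have key := hm.apply_top_eq_bot_iff (apply_mem_leftEnds i hs') (apply_mem_rightEnds j ht')
    (by have := hij t ht'; omega)
  rw [h.height_leftEnds hs', h.height_rightEnds ht'] at key
  constructor
  · intro e
    obtain ⟨heq, hR, hL⟩ := key.1 e
    refine ⟨by omega, fun r htr hrs => ?_, ?_⟩
    · have hr : r ∈ Set.Icc 1 p := ⟨by omega, by omega⟩
      have := h.strictAntiOn_i hr hs' hrs
      have := h.strictAntiOn_j ht' hr htr
      have := hij r hr
      have hjr := hR _ (apply_mem_rightEnds j hr) (by omega) (by omega)
      have hir := hL _ (apply_mem_leftEnds i hr) (by omega) (by omega)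
      rw [h.height_rightEnds hr] at hjr
      rw [h.height_leftEnds hr] at hir
      exact ⟨by omega, by omega⟩
    · rw [← h.setOf_mem_blocksWord_eq_genRange hm ht hts hsp e]
      exact h.saturatedIn_blocksWord cs (by omega) (by omega)
  · intro rule
    have heq := rule.eq
    refine key.2 ⟨by omega, fun z hz hsz hzt => ?_, fun z hz hsz hzt => ?_⟩
    · obtain ⟨r, hr, rfl⟩ := mem_rightEnds.1 hz
      have htr := (h.strictAntiOn_j.lt_iff_gt hr ht').1 (by omega)
      have := fun hrs => (rule.minimal r htr hrs).1
      rw [h.height_rightEnds hr]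
      omega
    · obtain ⟨r, hr, rfl⟩ := mem_leftEnds.1 hz
      have hrs := (h.strictAntiOn_i.lt_iff_gt hs' hr).1 hsz
      have := fun htr => (rule.minimal r htr hrs).2
      rw [h.height_leftEnds hr]
      omega

theorem posArrows_eq : posArrows (arrows m) =
    {a | ∃ t s, 1 ≤ t ∧ t < s ∧ s ≤ p ∧ PositiveRule cs i j t s ∧
      a = (.top (i s), .bot (j t + 1))} := by
  ext ⟨d, e⟩
  rw [mem_posArrows_arrows]
  constructor
  · rintro ⟨x, y, hxy, hm', rfl, rfl⟩
    obtain ⟨t, s, ht, hts, hsp, rfl, rfl⟩ := h.exists_of_apply_top_eq_bot hm hxy hm'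
    exact ⟨t, s, ht, hts, hsp, (h.apply_top_eq_bot_iff_positiveRule hm cs ht hts hsp).1 hm', rfl⟩
  · rintro ⟨t, s, ht, hts, hsp, rule, ⟨⟩⟩
    have := h.decr_i t s ht hts hsp
    have := (h.bounds t ht (by omega)).2.1
    exact ⟨i s, j t + 1, by omega,
      (h.apply_top_eq_bot_iff_positiveRule hm cs ht hts hsp).2 rule, rfl, rfl⟩

end IsStandardPair

/-! ### Arcs found greedily -/

section Greedy

variable {ι α : Type*} [LinearOrder α] {prec : ι → ι → Prop} (wf : WellFounded prec)
  {arc : ι → α → Prop} {candidates free : ι → Set α}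
  (mem_candidates : ∀ r v, arc r v → v ∈ candidates r)
  (injective : ∀ k r v, arc r v → prec k r → ¬ arc k v)
include wf mem_candidates injective

/-- The values of the partial function `arc` are found greedily: each one is the least candidate not
used before. -/
theorem arc_iff_isLeast
    (nested : ∀ r v x, arc r v → x ∈ candidates r → x < v → ∃ k, prec k r ∧ arc k x)
    (mem_free_iff : ∀ r x, x ∈ free r ↔
      (∃ v, arc r v) ∧ x ∈ candidates r ∧ ∀ k, prec k r → ¬ IsLeast (free k) x)
    (r : ι) (v : α) : arc r v ↔ IsLeast (free r) v := by
  induction r using wf.induction generalizing v with | _ r ih =>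
  have isLeast {v : α} (hv : arc r v) : IsLeast (free r) v := by
    refine ⟨(mem_free_iff r v).2 ⟨⟨v, hv⟩, mem_candidates r v hv, fun k hk => ?_⟩, fun x hx => ?_⟩
    · exact (ih k hk v).not.1 (injective k r v hv hk)
    · obtain ⟨-, hxr, hx⟩ := (mem_free_iff r x).1 hx
      by_contra! hxv
      obtain ⟨k, hk, hkx⟩ := nested r v x hv hxr hxv
      exact hx k hk ((ih k hk x).1 hkx)
  refine ⟨isLeast, fun hv => ?_⟩
  obtain ⟨w, hw⟩ := ((mem_free_iff r v).1 hv.1).1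
  exact hv.unique (isLeast hw) ▸ hw

theorem arc_iff_isGreatest
    (nested : ∀ r v x, arc r v → x ∈ candidates r → v < x → ∃ k, prec k r ∧ arc k x)
    (mem_free_iff : ∀ r x, x ∈ free r ↔
      (∃ v, arc r v) ∧ x ∈ candidates r ∧ ∀ k, prec k r → ¬ IsGreatest (free k) x)
    (r : ι) (v : α) : arc r v ↔ IsGreatest (free r) v :=
  arc_iff_isLeast (α := αᵒᵈ) wf mem_candidates injective nested mem_free_iff r v

end Greedy

theorem isLeast_iff_nonempty_and_eq_sInf {S : Set ℕ} {x : ℕ} :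
    IsLeast S x ↔ S.Nonempty ∧ x = sInf S :=
  ⟨fun h => ⟨h.nonempty, h.csInf_eq.symm⟩, by
    rintro ⟨hS, rfl⟩
    exact ⟨Nat.sInf_mem hS, fun _ => Nat.sInf_le⟩⟩

theorem isGreatest_iff_nonempty_and_eq_sSup {S : Set ℕ} (hS : BddAbove S) {x : ℕ} :
    IsGreatest S x ↔ S.Nonempty ∧ x = sSup S :=
  ⟨fun h => ⟨h.nonempty, h.csSup_eq.symm⟩, by
    rintro ⟨hne, rfl⟩
    exact ⟨Nat.sSup_mem hne hS, fun _ => le_csSup hS⟩⟩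

section Sets

variable {p : ℕ} {i j : ℕ → ℕ} {P : Set Arrow}

theorem mem_setA_iff (hP : .top (i 1) ∉ tails P) (r : Set.Icc 1 p) (x : ℕ) :
    x ∈ setA i j P r ↔ .top (i r) ∉ tails P ∧
      (x ∈ Set.Icc (i r + 1) (j 1 + 1) ∧ ∀ k : Set.Icc 1 p, k < r → x ≠ i k) ∧
      ∀ k : Set.Icc 1 p, k < r → ¬ IsLeast (setA i j P k) x := by
  obtain ⟨r, hr, hrp⟩ := r
  simp only [← Subtype.coe_lt_coe, Subtype.forall, isLeast_iff_nonempty_and_eq_sInf, not_and]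
  rw [setA]
  split_ifs with h
  · subst h
    have hk (k : ℕ) (hk : k ∈ Set.Icc 1 p) : ¬ k < 1 := hk.1.not_gt
    simp +contextual [hP, hk]
  · simp only [Set.mem_ofPred_eq, and_assoc]
    grind

theorem bddAbove_setB (r : ℕ) : BddAbove (setB p i j P r) := by
  rw [setB]
  split_ifs
  · exact bddAbove_Icc
  · exact bddAbove_Icc.mono fun x hx => hx.2.1

theorem mem_setB_iff (hP : .bot (j p + 1) ∉ heads P) (r : Set.Icc 1 p) (x : ℕ) :
    x ∈ setB p i j P r ↔ .bot (j r + 1) ∉ heads P ∧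
      (x ∈ Set.Icc (i p) (j r) ∧ ∀ k : Set.Icc 1 p, r < k → x ≠ j k + 1) ∧
      ∀ k : Set.Icc 1 p, r < k → ¬ IsGreatest (setB p i j P k) x := by
  obtain ⟨r, hr, hrp⟩ := r
  simp only [← Subtype.coe_lt_coe, Subtype.forall,
    isGreatest_iff_nonempty_and_eq_sSup (bddAbove_setB _), not_and]
  rw [setB]
  split_ifs with h
  · subst h
    have hk (k : ℕ) (hk : k ∈ Set.Icc 1 r) : ¬ r < k := hk.2.not_gt
    simp +contextual [hP, hk]
  · simp only [Set.mem_ofPred_eq, and_assoc]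
    grind

end Sets

namespace IsStandardPair

variable {n p : ℕ} {i j : ℕ → ℕ} (h : IsStandardPair n p i j) {m : Dot → Dot}
  (hm : HasEnds n m (leftEnds p i) (rightEnds p j))
include h hm

theorem top_notMem_tails_posArrows : .top (i 1) ∉ tails (posArrows (arrows m)) := by
  rw [top_mem_tails_posArrows]
  rintro ⟨y, hy, e⟩
  obtain ⟨t, s, ht, hts, hsp, hi, -⟩ := h.exists_of_apply_top_eq_bot hm hy e
  have := h.decr_i 1 s le_rfl (by omega) hsp
  omega

theorem bot_notMem_heads_posArrows : .bot (j p + 1) ∉ heads (posArrows (arrows m)) := by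
  rw [bot_mem_heads_posArrows]
  rintro ⟨x, hx, e⟩
  obtain ⟨t, s, ht, hts, hsp, -, hj⟩ := h.exists_of_apply_top_eq_bot hm hx e
  have := h.decr_j t p ht (by omega) le_rfl
  omega

theorem apply_top_eq_top_iff (r : Set.Icc 1 p) (v : ℕ) :
    m (.top (i r)) = .top v ↔ IsLeast (setA i j (posArrows (arrows m)) r) v := by
  refine arc_iff_isLeast (arc := fun (r : Set.Icc 1 p) v => m (.top (i r)) = .top v)
    (candidates := fun r => {x | x ∈ Set.Icc (i r + 1) (j 1 + 1) ∧ ∀ k < r, x ≠ i k})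
    (free := fun r => setA i j (posArrows (arrows m)) r)
    wellFounded_lt ?_ ?_ ?_ (fun r x => ?_) r v
  · intro r v hv
    have hlt := hm.lt_of_apply_eq_top (apply_mem_leftEnds i r.2) hv
    obtain ⟨y, hy, hvy⟩ := hm.exists_le_right_of_arc_top hv hlt
    obtain ⟨k, hk, rfl⟩ := mem_rightEnds.1 hy
    have := h.strictAntiOn_j.antitoneOn ⟨le_rfl, hk.1.trans hk.2⟩ hk hk.1
    refine ⟨⟨hlt, by omega⟩, fun k _ hvk => ?_⟩
    have hvL : v ∈ leftEnds p i := hvk ▸ apply_mem_leftEnds i k.2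
    exact hlt.asymm (hm.lt_of_apply_eq_top hvL (by rw [← hv, hm.invol]))
  · intro k r v hr hkr hk
    have := h.strictAntiOn_i k.2 r.2 hkr
    have := hm.invol.injective (hk.trans hr.symm)
    rw [Dot.top.injEq] at this
    omega
  · rintro r v x hv ⟨⟨hrx, -⟩, hx⟩ hxv
    have hxL : x ∉ leftEnds p i := fun hxL => by
      obtain ⟨k, hk, rfl⟩ := mem_leftEnds.1 hxL
      exact hx ⟨k, hk⟩ ((h.strictAntiOn_i.lt_iff_gt r.2 hk).1 hrx) rfl
    obtain ⟨w, hw, hrw, e⟩ := hm.exists_arc_of_nested_top hv hrx hxv hxL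
    obtain ⟨k, hk, rfl⟩ := mem_leftEnds.1 hw
    exact ⟨⟨k, hk⟩, (h.strictAntiOn_i.lt_iff_gt r.2 hk).1 hrw, e⟩
  · rw [mem_setA_iff (h.top_notMem_tails_posArrows hm),
      hm.top_notMem_tails_posArrows (apply_mem_leftEnds i r.2)]
    exact Iff.rfl

theorem le_of_apply_bot {r u : ℕ} (hr : r ∈ Set.Icc 1 p) (hu : m (.bot (j r + 1)) = .bot u) :
    i p ≤ u := by
  have hr' := apply_mem_rightEnds j hr
  have hon := hm.isOn_apply (hm.isOn_bot hr')
  rw [hu] at hon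
  by_contra! hup
  have hvert := hm.apply_top_of_lt hon.1 hon.2 fun z hz => by
    obtain ⟨k, hk, rfl⟩ := mem_leftEnds.1 hz
    exact hup.trans_le (h.strictAntiOn_i.antitoneOn hk ⟨hk.1.trans hk.2, le_rfl⟩ hk.2)
  cases hm.invol.injective (hu.trans hvert.symm)

theorem apply_bot_eq_bot_iff (r : Set.Icc 1 p) (u : ℕ) :
    m (.bot (j r + 1)) = .bot u ↔ IsGreatest (setB p i j (posArrows (arrows m)) r) u := by
  refine arc_iff_isGreatest (arc := fun (r : Set.Icc 1 p) u => m (.bot (j r + 1)) = .bot u)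
    (candidates := fun r => {x | x ∈ Set.Icc (i p) (j r) ∧ ∀ k > r, x ≠ j k + 1})
    (free := fun r => setB p i j (posArrows (arrows m)) r)
    wellFounded_gt ?_ ?_ ?_ (fun r x => ?_) r u
  · intro r u hu
    have hlt := hm.lt_of_apply_eq_bot (apply_mem_rightEnds j r.2) hu
    refine ⟨⟨h.le_of_apply_bot hm r.2 hu, Nat.le_of_lt_succ hlt⟩, fun k _ huk => ?_⟩
    have huR : u ∈ rightEnds p j := huk ▸ apply_mem_rightEnds j k.2
    exact hlt.asymm (hm.lt_of_apply_eq_bot huR (by rw [← hu, hm.invol]))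
  · intro k r u hr hrk hk
    have := h.strictAntiOn_j r.2 k.2 hrk
    have := hm.invol.injective (hk.trans hr.symm)
    rw [Dot.bot.injEq] at this
    omega
  · rintro r u x hu ⟨⟨-, hxr⟩, hx⟩ hux
    have hxR : x ∉ rightEnds p j := fun hxR => by
      obtain ⟨k, hk, rfl⟩ := mem_rightEnds.1 hxR
      exact hx ⟨k, hk⟩ ((h.strictAntiOn_j.lt_iff_gt hk r.2).1 hxr) rfl
    obtain ⟨w, hw, hwr, e⟩ := hm.exists_arc_of_nested_bot hu hux (Nat.lt_succ_of_le hxr) hxR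
    obtain ⟨k, hk, rfl⟩ := mem_rightEnds.1 hw
    exact ⟨⟨k, hk⟩, (h.strictAntiOn_j.lt_iff_gt hk r.2).1 (Nat.lt_of_succ_lt_succ hwr), e⟩
  · rw [mem_setB_iff (h.bot_notMem_heads_posArrows hm),
      hm.bot_notMem_heads_posArrows (apply_mem_rightEnds j r.2)]
    exact Iff.rfl

theorem topArrows_eq : topArrows (arrows m) =
    {a | ∃ r, 1 ≤ r ∧ r ≤ p ∧ (setA i j (posArrows (arrows m)) r).Nonempty ∧
      a = (.top (i r), .top (sInf (setA i j (posArrows (arrows m)) r)))} := by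
  ext ⟨d, e⟩
  rw [mem_topArrows_arrows]
  constructor
  · rintro ⟨x, v, hxv, e, rfl, rfl⟩
    obtain ⟨r, hr, rfl⟩ := mem_leftEnds.1 (hm.mem_left_of_apply_eq_top e hxv)
    have hleast := (h.apply_top_eq_top_iff hm ⟨r, hr⟩ v).1 e
    obtain ⟨hne, rfl⟩ := isLeast_iff_nonempty_and_eq_sInf.1 hleast
    exact ⟨r, hr.1, hr.2, hne, rfl⟩
  · rintro ⟨r, hr, hrp, hne, ⟨⟩⟩
    have e := (h.apply_top_eq_top_iff hm ⟨r, hr, hrp⟩ _).2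
      (isLeast_iff_nonempty_and_eq_sInf.2 ⟨hne, rfl⟩)
    exact ⟨i r, _, hm.lt_of_apply_eq_top (apply_mem_leftEnds i ⟨hr, hrp⟩) e, e, rfl, rfl⟩

theorem botArrows_eq : botArrows (arrows m) =
    {a | ∃ r, 1 ≤ r ∧ r ≤ p ∧ (setB p i j (posArrows (arrows m)) r).Nonempty ∧
      a = (.bot (sSup (setB p i j (posArrows (arrows m)) r)), .bot (j r + 1))} := by
  ext ⟨d, e⟩
  rw [mem_botArrows_arrows]
  constructor
  · rintro ⟨u, y, huy, e, rfl, rfl⟩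
    obtain ⟨r, hr, rfl⟩ := mem_rightEnds.1 (hm.mem_right_of_apply_bot_eq_bot e huy)
    have hgreatest := (h.apply_bot_eq_bot_iff hm ⟨r, hr⟩ u).1 (by rw [← e, hm.invol])
    obtain ⟨hne, rfl⟩ := (isGreatest_iff_nonempty_and_eq_sSup (bddAbove_setB r)).1 hgreatest
    exact ⟨r, hr.1, hr.2, hne, rfl⟩
  · rintro ⟨r, hr, hrp, hne, ⟨⟩⟩
    have e := (h.apply_bot_eq_bot_iff hm ⟨r, hr, hrp⟩ _).2
      ((isGreatest_iff_nonempty_and_eq_sSup (bddAbove_setB r)).2 ⟨hne, rfl⟩)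
    exact ⟨_, j r + 1, hm.lt_of_apply_eq_bot (apply_mem_rightEnds j ⟨hr, hrp⟩) e,
      by rw [← e, hm.invol], rfl, rfl⟩

end IsStandardPair

end FCDiagram

theorem mainTheorem2 (n : ℕ) {W : Type*} [Group W] (cs : CoxeterSystem (CoxeterMatrix.A n) W)
    (p : ℕ) (i j : ℕ → ℕ) (hij : FCDiagram.IsStandardPair n p i j)
    (D : Set FCDiagram.Arrow) (hD : D = FCDiagram.diagram n p i j) :
    FCDiagram.IsDiagram n D ∧
    FCDiagram.setI n D = {x | ∃ k, 1 ≤ k ∧ k ≤ p ∧ x = i k} ∧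
    FCDiagram.setJ n D = {x | ∃ k, 1 ≤ k ∧ k ≤ p ∧ x = j k} ∧
    FCDiagram.posArrows D =
      {a | ∃ t s, 1 ≤ t ∧ t < s ∧ s ≤ p ∧ FCDiagram.PositiveRule cs i j t s ∧
        a = (.top (i s), .bot (j t + 1))} ∧
    FCDiagram.topArrows D =
      {a | ∃ r, 1 ≤ r ∧ r ≤ p ∧ (FCDiagram.setA i j (FCDiagram.posArrows D) r).Nonempty ∧
        a = (.top (i r), .top (sInf (FCDiagram.setA i j (FCDiagram.posArrows D) r)))} ∧
    FCDiagram.botArrows D =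
      {a | ∃ r, 1 ≤ r ∧ r ≤ p ∧ (FCDiagram.setB p i j (FCDiagram.posArrows D) r).Nonempty ∧
        a = (.bot (sSup (FCDiagram.setB p i j (FCDiagram.posArrows D) r)), .bot (j r + 1))} := by
  obtain ⟨m, hm, hdiagram⟩ := hij.exists_hasEnds
  rw [hdiagram] at hD
  subst hD
  refine ⟨hm.isDiagram, ?_, ?_, hij.posArrows_eq hm cs, hij.topArrows_eq hm, hij.botArrows_eq hm⟩
  · rw [hm.setI_eq]
    ext x
    simp only [Finset.mem_coe, FCDiagram.mem_leftEnds, Set.mem_ofPred_eq, and_assoc, eq_comm]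
  · rw [hm.setJ_eq]
    ext x
    simp only [FCDiagram.mem_rightEnds, Set.mem_ofPred_eq, and_assoc, Nat.add_right_cancel_iff,
      eq_comm]
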